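/- Let $p$ be a prime, $K$ an unramified finite extension of $\mathbb{Q}_p$ with ring of integers $\mathcal{O}_K$, and let $h\in\mathcal{O}_K[[t]]$ with $h(0)=1$. For $g\in K[[t]]$ let $Y(g)\in K[[t]]$ be the unique power series $y$ with $y(0)=0$ and $y'=g\cdot h(y)$, and let $N_g(u)=u-h(u)\int\left(\frac{u'}{h(u)}-g\right)$, where $\int f$ is the primitive of $f$ with constant coefficient $0$. Elements of $\mathcal{O}_K/p^\lambda\mathcal{O}_K$ are written in coordinates in $\mathbb{Z}/p^\lambda\mathbb{Z}$ with respect to a fixed $\mathbb{Z}_p$-basis of $\mathcal{O}_K$. In the fixed precision model, at precision $\lambda$, all computations are done in $\mathcal{O}_K/p^\lambda\mathcal{O}_K$; a division $a/m$ of $a\in\mathcal{O}_K/p^\lambda\mathcal{O}_K$ by a positive integer $m$ returns the $c$ with $mc=a$ whose coordinates are the smallest nonnegative integers possible, and raises an error if there is no such $c$. The procedure $\mathrm{DSol}(g,h,n)$, with $g$ and $h$ given modulo $(p^\lambda,t^n)$, returns $0 \bmod t$ if $n=0$, and otherwise computes $u=\mathrm{DSol}(g,h,\lceil\frac{n-1}{2}\rceil)$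 and returns $N_g(u) \bmod t^{n+1}$, computed in the fixed precision model. Let $n\ge 0$, $\kappa>0$ (or $\kappa>1$ if $p=2$) and $\lambda\ge\lfloor\log_p n\rfloor+\kappa$ be integers (where $\lfloor\log_p n\rfloor$ is read as $0$ for $n=0$). 1. For all $g\in\mathcal{O}_K[[t]]$ such that $Y(g) \bmod t^{n+1}$ has coefficients in $\mathcal{O}_K$ (in particular whenever $Y(g)\in\mathcal{O}_K[[t]]$), the procedure $\mathrm{DSol}(g,h,n)$ raises no error and its output equals $Y(g)$ modulo $(p^\kappa,t^{n+1})$. 2. $\mathrm{DSol}(g,h,n)$ can be carried out with $O\left(M_{\mathcal{O}_K}(p^\lambda,n)+C_h(p^\lambda,n)\right)$ bit operations, where the implied constant is absolute. Here bit operations are the gates of Boolean circuits of fan-in two; $M_{\mathcal{O}_K}(p^\lambda,k)$ is a bound on the number of bit operations for the product of two polynomials of degree at most $k$ over $\mathcal{O}_K/p^\lambda\mathcal{O}_K$; $C_h(p^\lambda,k)$ is a bound on the number of bit operations for computing $h(f)$ modulo $(p^\lambda,t^k)$ from $f\in t\mathcal{O}_K[[t]]$ given modulo $(p^\lambda,t^k)$;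 and both bounds are assumed to be nondecreasing in $k$ and to satisfy $M_{\mathcal{O}_K}(p^\lambda,2k)\ge 2M_{\mathcal{O}_K}(p^\lambda,k)$ and $C_h(p^\lambda,2k)\ge 2C_h(p^\lambda,k)$ for $k\ge 1$. More precisely, there are circuits for the single Newton iterations such that the circuit for $\mathrm{DSol}(g,h,n)$ obtained by running the circuit of the recursive call followed by that of the last iteration (and raising an error if one of the two does) computes the output of $\mathrm{DSol}(g,h,n)$, including its error flag, for every input $g$, and has this size. -/

import Mathlib

open PowerSeries

namespace PadicODE

noncomputable section

/-! ### The exact solution -/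

/-- The differential equation `y' = g * h(y)` with initial condition `y(0) = 0`. -/
def IsSolution {K : Type*} [Field K] (h g y : K⟦X⟧) : Prop :=
  constantCoeff y = 0 ∧ d⁄dX K y = g * h.subst y

/-- The primitive with constant coefficient zero. -/
def primitive {K : Type*} [Field K] (f : K⟦X⟧) : K⟦X⟧ :=
  PowerSeries.mk fun i => coeff (i - 1) f / (i : K)

theorem constantCoeff_primitive {K : Type*} [Field K] (f : K⟦X⟧) :
    constantCoeff (primitive f) = 0 := by
  rw [← coeff_zero_eq_constantCoeff_apply]
  simp [primitive]

theorem derivative_primitive {K : Type*} [Field K] [CharZero K] (f : K⟦X⟧) :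
    d⁄dX K (primitive f) = f := by
  ext i
  rw [coeff_derivative]
  have hi : (i : K) + 1 ≠ 0 := Nat.cast_add_one_ne_zero i
  simp only [primitive, coeff_mk, Nat.add_sub_cancel, Nat.cast_add, Nat.cast_one]
  field_simp

/-- If `h(0) = 1`, the equation has exactly one power series solution. -/
theorem existsUnique_isSolution {K : Type*} [Field K] [CharZero K] (h g : K⟦X⟧)
    (hh : constantCoeff h = 1) : ∃! y : K⟦X⟧, IsSolution h g y := by
  have hne : constantCoeff h ≠ 0 := by rw [hh]; exact one_ne_zero
  have hinv : h * h⁻¹ = 1 := PowerSeries.mul_inv_cancel h hne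
  set P := primitive h⁻¹ with hP
  have hP0 : constantCoeff P = 0 := constantCoeff_primitive _
  have hP1 : d⁄dX K P = h⁻¹ := derivative_primitive _
  have hc1 : IsUnit (coeff 1 P) := by
    have h1 : coeff 1 P = 1 := by
      simp [hP, primitive, hh]
    rw [h1]; exact isUnit_one
  set Q := substInvOfIsUnit P hc1 with hQ
  have hQs : HasSubst Q := HasSubst.substInvOfIsUnit P hc1
  have hQ0 : constantCoeff Q = 0 := constantCoeff_substInvOfIsUnit P hc1
  have hPs : HasSubst P := HasSubst.of_constantCoeff_zero' hP0
  have hPQ : P.subst Q = (X : K⟦X⟧) := subst_substInvOfIsUnit_right P hP0 hc1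
  have hQP : Q.subst P = (X : K⟦X⟧) := subst_substInvOfIsUnit_left P hP0 hc1
  have hG0 : constantCoeff (primitive g) = 0 := constantCoeff_primitive _
  have hGs : HasSubst (primitive g) := HasSubst.of_constantCoeff_zero' hG0
  have key : ∀ y : K⟦X⟧, HasSubst y → h.subst y * (h⁻¹).subst y = (1 : K⟦X⟧) := by
    intro y hy
    rw [← subst_mul hy, hinv, ← coe_substAlgHom hy, map_one]
  have hQd : d⁄dX K Q = h.subst Q := by
    have h1 : d⁄dX K (P.subst Q) = (h⁻¹).subst Q * d⁄dX K Q := by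
      rw [derivative_subst hQs, hP1]
    rw [hPQ, derivative_X] at h1
    calc d⁄dX K Q = (h.subst Q * (h⁻¹).subst Q) * d⁄dX K Q := by rw [key Q hQs, one_mul]
      _ = h.subst Q * ((h⁻¹).subst Q * d⁄dX K Q) := by ring
      _ = h.subst Q := by rw [← h1, mul_one]
  refine ⟨Q.subst (primitive g), ⟨?_, ?_⟩, ?_⟩
  · exact constantCoeff_subst_eq_zero hG0 Q hQ0
  · rw [derivative_subst hGs, hQd, derivative_primitive,
      subst_comp_subst_apply hQs hGs, mul_comm]
  · rintro y ⟨hy0, hy⟩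
    have hys : HasSubst y := HasSubst.of_constantCoeff_zero' hy0
    have h2 : P.subst y = primitive g := by
      apply derivative.ext
      · rw [derivative_subst hys, hP1, derivative_primitive, hy]
        calc (h⁻¹).subst y * (g * h.subst y) = g * (h.subst y * (h⁻¹).subst y) := by ring
          _ = g := by rw [key y hys, mul_one]
      · rw [hG0]
        exact constantCoeff_subst_eq_zero hy0 P hP0
    rw [← h2, ← subst_comp_subst_apply hPs hys, hQP, subst_X hys]

/-- `Y h g` is the solution of `y' = g * h(y)`, `y(0) = 0`; it exists and is unique as soon as
`h(0) = 1`, by `existsUnique_isSolution`. -/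
def Y {K : Type*} [Field K] (h g : K⟦X⟧) : K⟦X⟧ :=
  Classical.epsilon (IsSolution h g)

theorem isSolution_Y {K : Type*} [Field K] [CharZero K] (h g : K⟦X⟧)
    (hh : constantCoeff h = 1) : IsSolution h g (Y h g) :=
  Classical.epsilon_spec (existsUnique_isSolution h g hh).exists

/-! ### The fixed precision model

`O` is the ring of integers, `b : Fin d → O` the basis of `O` over the `p`-adic integers in which
elements are written, and `lam` the working precision. -/

/-- The ring `O / p ^ lam`. -/
abbrev ModPow (O : Type*) [CommRing O] (p lam : ℕ) : Type _ :=
  O ⧸ Ideal.span {(p : O) ^ lam}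

/-- The reduction `O → O / p ^ lam`. -/
abbrev red {O : Type*} [CommRing O] (p lam : ℕ) : O →+* ModPow O p lam :=
  Ideal.Quotient.mk _

/-- The element `∑ j, a j * b j` of `O / p ^ lam`. -/
def ofCoords {O : Type*} [CommRing O] (p lam : ℕ) {d : ℕ} (b : Fin d → O) (a : Fin d → ℕ) :
    ModPow O p lam :=
  ∑ j, (a j : ModPow O p lam) * red p lam (b j)

open Classical in
/-- Division of `a` by the integer `m` at fixed precision `lam`. If `m * c = a` has a solution `c`
in `O / p ^ lam`, the result is the solution with the smallest coordinates (for `O = ℤ_p` with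
basis `1`, the class of the smallest integer `c ≥ 0` with `a = m * c`); otherwise an error is
raised, which is the value `none`. -/
def fixedDiv {O : Type*} [CommRing O] (p lam : ℕ) {d : ℕ} (b : Fin d → O)
    (a : ModPow O p lam) (m : ℕ) : Option (ModPow O p lam) :=
  if ∃ c : Fin d → ℕ, (m : ModPow O p lam) * ofCoords p lam b c = a then
    some (ofCoords p lam b fun j =>
      sInf {k : ℕ | ∃ c : Fin d → ℕ, (m : ModPow O p lam) * ofCoords p lam b c = a ∧ c j = k})
  else none

open Classical in
/-- The primitive of `e` modulo `t ^ (n + 1)`, computed at fixed precision: the coefficient of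
`t ^ (i + 1)` is the quotient of the coefficient of `t ^ i` in `e` by `i + 1`. An error is raised
if one of these divisions raises one. -/
def fixedPrimitive {O : Type*} [CommRing O] (p lam : ℕ) {d : ℕ} (b : Fin d → O) (n : ℕ)
    (e : (ModPow O p lam)⟦X⟧) : Option (Polynomial (ModPow O p lam)) :=
  if ∀ i < n, (fixedDiv p lam b (coeff i e) (i + 1)).isSome then
    some (∑ i ∈ Finset.range n,
      Polynomial.monomial (i + 1) ((fixedDiv p lam b (coeff i e) (i + 1)).getD 0))
  else none

/-- The Newton operator `u - h(u) * ∫ (u' / h(u) - g)` modulo `t ^ (n + 1)`, computed at fixed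
precision. It is applied with `h(u)` of constant coefficient `1`. -/
def newtonStep {O : Type*} [CommRing O] (p lam : ℕ) {d : ℕ} (b : Fin d → O) (n : ℕ)
    (g h u : Polynomial (ModPow O p lam)) : Option (Polynomial (ModPow O p lam)) :=
  let hu : (ModPow O p lam)⟦X⟧ := (h.comp u : Polynomial (ModPow O p lam))
  let e : (ModPow O p lam)⟦X⟧ :=
    (Polynomial.derivative u : Polynomial (ModPow O p lam)) * invOfUnit hu 1 - g
  (fixedPrimitive p lam b n e).map fun E => trunc (n + 1) (u - hu * E)

/-- The algorithm: it returns `0` for `n = 0`, and otherwise applies the Newton operator modulo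
`t ^ (n + 1)` to the output of the recursive call with `⌈(n - 1) / 2⌉`. An error raised on the way
is an error of the algorithm. -/
def DSol {O : Type*} [CommRing O] (p lam : ℕ) {d : ℕ} (b : Fin d → O)
    (g h : Polynomial (ModPow O p lam)) : ℕ → Option (Polynomial (ModPow O p lam))
  | 0 => some 0
  | n + 1 => (DSol p lam b g h ((n + 1) / 2)).bind fun u => newtonStep p lam b (n + 1) g h u
  termination_by n => n
  decreasing_by omega

/-! ### Bit operations -/

/-- Boolean circuits with inputs indexed by `α` and outputs indexed by `β`. -/
inductive BoolCircuit : Type → Type → Type 1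
  /-- duplicating, permuting and dropping wires -/
  | wire {α β : Type} (f : β → α) : BoolCircuit α β
  /-- a constant bit -/
  | const (c : Bool) : BoolCircuit Empty Unit
  /-- one bit operation -/
  | gate (op : Bool → Bool → Bool) : BoolCircuit (Unit ⊕ Unit) Unit
  /-- serial composition -/
  | seq {α β γ : Type} (s : BoolCircuit α β) (t : BoolCircuit β γ) : BoolCircuit α γ
  /-- parallel composition -/
  | par {α β γ δ : Type} (s : BoolCircuit α β) (t : BoolCircuit γ δ) :
      BoolCircuit (α ⊕ γ) (β ⊕ δ)

/-- The outputs of a circuit on given inputs. -/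
def BoolCircuit.eval : {α β : Type} → BoolCircuit α β → (α → Bool) → β → Bool
  | _, _, .wire f, x => fun j => x (f j)
  | _, _, .const c, _ => fun _ => c
  | _, _, .gate op, x => fun _ => op (x (Sum.inl ())) (x (Sum.inr ()))
  | _, _, .seq s t, x => t.eval (s.eval x)
  | _, _, .par s t, x =>
      Sum.elim (s.eval fun i => x (Sum.inl i)) (t.eval fun i => x (Sum.inr i))

/-- The number of bit operations of a circuit, that is, its number of gates. -/
def BoolCircuit.size : {α β : Type} → BoolCircuit α β → ℕ
  | _, _, .wire _ => 0
  | _, _, .const _ => 0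
  | _, _, .gate _ => 1
  | _, _, .seq s t => s.size + t.size
  | _, _, .par s t => s.size + t.size

/-- Index set of the bits that represent a polynomial of degree less than `n` over `O / p ^ lam`,
where `O` has rank `d`: each of the `n` coefficients has `d` coordinates, and each coordinate is an
integer in `[0, p ^ lam)` written with the least sufficient number of bits. -/
abbrev PolyBits (p lam d n : ℕ) : Type :=
  Fin n × Fin d × Fin (Nat.size (p ^ lam - 1))

/-- The integer coordinate number `j` of the coefficient number `i`. -/
def coordOf {p lam d n : ℕ} (x : PolyBits p lam d n → Bool) (i : Fin n) (j : Fin d) : ℕ :=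
  ∑ k : Fin (Nat.size (p ^ lam - 1)), if x (i, j, k) then 2 ^ (k : ℕ) else 0

/-- The bits `x` represent the polynomial `f`. -/
def Encodes {O : Type*} [CommRing O] {p lam d n : ℕ} (b : Fin d → O)
    (x : PolyBits p lam d n → Bool) (f : Polynomial (ModPow O p lam)) : Prop :=
  (∀ i j, coordOf x i j < p ^ lam) ∧
    f = ∑ i : Fin n, Polynomial.monomial (i : ℕ) (ofCoords p lam b (coordOf x i))

/-- The bits `x`, the last of which is an error flag, represent the result `r` of a computation
that may raise an error. -/
def EncodesResult {O : Type*} [CommRing O] {p lam d n : ℕ} (b : Fin d → O)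
    (x : PolyBits p lam d n ⊕ Unit → Bool) : Option (Polynomial (ModPow O p lam)) → Prop
  | none => x (Sum.inr ()) = true
  | some f => x (Sum.inr ()) = false ∧ Encodes b (fun i => x (Sum.inl i)) f

/-- The circuit multiplies two polynomials of degree at most `n` over `O / p ^ lam`. -/
def ComputesMul {O : Type*} [CommRing O] {p lam d : ℕ} (b : Fin d → O) (n : ℕ)
    (c : BoolCircuit (PolyBits p lam d (n + 1) ⊕ PolyBits p lam d (n + 1))
      (PolyBits p lam d (2 * n + 1))) : Prop :=
  ∀ x y f g, Encodes b x f → Encodes b y g → Encodes b (c.eval (Sum.elim x y)) (f * g)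

/-- The circuit computes `h(f)` modulo `t ^ n` over `O / p ^ lam`, given `f` modulo `t ^ n` with
constant coefficient zero. -/
def ComputesComp {O : Type*} [CommRing O] {p lam d : ℕ} (b : Fin d → O)
    (h : (ModPow O p lam)⟦X⟧) (n : ℕ)
    (c : BoolCircuit (PolyBits p lam d n) (PolyBits p lam d n)) : Prop :=
  ∀ x f, Encodes b x f → f.coeff 0 = 0 →
    Encodes b (c.eval x)
      (trunc n ((trunc n h).comp f : Polynomial (ModPow O p lam)))

/-- The circuit performs the last iteration of the algorithm for the parameter `n`: from `g` modulo
`t ^ n` and `u` modulo `t ^ (m + 1)`, where `m = ⌈(n - 1) / 2⌉`, it computes the Newton operator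
modulo `t ^ (n + 1)` at fixed precision. -/
def ComputesNewtonStep {O : Type*} [CommRing O] {p lam d : ℕ} (b : Fin d → O)
    (h : (ModPow O p lam)⟦X⟧) (n : ℕ)
    (c : BoolCircuit (PolyBits p lam d n ⊕ PolyBits p lam d (n / 2 + 1))
      (PolyBits p lam d (n + 1) ⊕ Unit)) : Prop :=
  ∀ x y g u, Encodes b x g → Encodes b y u → u.coeff 0 = 0 →
    EncodesResult b (c.eval (Sum.elim x y)) (newtonStep p lam b n g (trunc n h) u)

/-- The circuit that runs the algorithm, given circuits `S n` for the single iterations: for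
`n = 0` it returns `0`; otherwise it runs the circuit for `⌈(n - 1) / 2⌉` on the first coefficients
of `g`, then the circuit `S n`, and raises an error if one of the two does. -/
def dsolCircuit {p lam d : ℕ}
    (S : ∀ n : ℕ, BoolCircuit (PolyBits p lam d n ⊕ PolyBits p lam d (n / 2 + 1))
      (PolyBits p lam d (n + 1) ⊕ Unit)) :
    (n : ℕ) → BoolCircuit (PolyBits p lam d n) (PolyBits p lam d (n + 1) ⊕ Unit)
  | 0 =>
      -- all outputs are a copy of the constant `false`
      .seq (.wire (Empty.elim : Empty → PolyBits p lam d 0))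
        (.seq (.const false) (.wire fun _ => ()))
  | n + 1 =>
      have hm : (n + 1) / 2 ≤ n + 1 := Nat.div_le_self _ _
      -- from `g` to (`g` modulo `t ^ m`, `g`)
      .seq (.wire (Sum.elim (fun z => (Fin.castLE hm z.1, z.2)) id))
        -- to ((`u`, flag), `g`)
        (.seq (.par (dsolCircuit S ((n + 1) / 2)) (.wire id))
          -- to ((`g`, `u`), flag)
          (.seq (.wire (Sum.elim
              (Sum.elim Sum.inr fun z => Sum.inl (Sum.inl z)) fun _ => Sum.inl (Sum.inr ())))
            -- to ((result, new flag), flag)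
            (.seq (.par (S (n + 1)) (.wire id))
              -- to (result, (new flag, flag))
              (.seq (.wire (Sum.elim (fun z => Sum.inl (Sum.inl z))
                  (Sum.elim (fun _ => Sum.inl (Sum.inr ())) Sum.inr)))
                (.par (.wire id) (.gate or))))))
  termination_by n => n
  decreasing_by omega

end

end PadicODE

set_option linter.unusedSectionVars false

/-! Put `a = 1/h` and `A = ∫ a`, so that the equation reads `a(y) y' = g`, or `A(y) = ∫ g`. The
series `A` has denominators, but differences of its values are well behaved: if `z ≡ y` modulo `p^k`
with `k > 0`, then `N p^k` divides `z^N - y^N` (`natCast_mul_dvd_pow_sub_pow`), so every term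
`a_(N-1) (z^N - y^N) / N` of `A(z) - A(y)` is divisible by `p^k` over `O`. Both halves of the
correctness rest on this.

No error is raised: if `u` agrees with `y` modulo `(p^κ, t^(m+1))`, expanding to second order in the
`t^(m+1)`-part of the difference shows that `A(u) - A(y)` is integral modulo `t^(2m+2)`. Its
derivative `u'/h(u) - g` can therefore be integrated over `O`, hence in `O/p^lam`
(`natCast_dvd_coeff_aeval_mul_derivative_sub`).

Precision is controlled backwards. Over any commutative ring a Newton step doubles the order of the
residue, provided that the integral used is an exact primitive with the right order of vanishing
(`X_pow_dvd_newton`). So the output solves the equation exactly in `O/p^lam`, modulo `t^n`, and each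
of its lifts solves an equation with `g` perturbed by a multiple of `p^lam`. The stability statement
`pow_dvd_coeff_sub_of_pow_dvd` turns this into an error divisible by `p^κ`: the `log_p n` digits are
lost once and not at every iteration. The same bound, at half the order, feeds the absence of errors
in the next step.

For the cost, an iteration consists of one composition, a Newton inversion, a bounded number of
products, `n` divisions, and work linear in the number of bits. The linear work is absorbed by `M`,
because a multiplication circuit must feed every bit of its first factor into a gate
(`ComputesMul.le_size`). Division by `i` is a product with a constant followed by long division by
`p^v`, `v = v_p(i)`; by Legendre's formula these divisions are linear in total
(`sum_padicValNat_mul_size_le`). The doubling hypotheses bound the cost of the recursion by twice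
that of the last iteration. -/

namespace PadicODE

/-! ### Coordinates in `O / p ^ lam` -/

section Coordinates

variable {p : ℕ} [Fact p.Prime] {O : Type*} [CommRing O] [Algebra ℤ_[p] O] {d : ℕ}
  (b : Module.Basis (Fin d) ℤ_[p] O) {lam : ℕ}

theorem padicInt_pow_dvd_natCast_sub_iff (a a' : ℕ) :
    (p : ℤ_[p]) ^ lam ∣ (a : ℤ_[p]) - a' ↔ a ≡ a' [MOD p ^ lam] := by
  rw [Nat.ModEq.comm, Nat.modEq_iff_dvd, ← Ideal.mem_span_singleton,
    ← PadicInt.norm_le_pow_iff_mem_span_pow]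
  have h := PadicInt.norm_int_le_pow_iff_dvd (p := p) (k := (a : ℤ) - a') (n := lam)
  push_cast at h ⊢
  exact h

theorem pow_dvd_iff_repr (x : O) :
    (p : O) ^ lam ∣ x ↔ ∀ j, (p : ℤ_[p]) ^ lam ∣ b.repr x j := by
  have hp : ((p : O) ^ lam) = algebraMap ℤ_[p] O ((p : ℤ_[p]) ^ lam) := by simp
  constructor
  · rintro ⟨c, rfl⟩ j
    rw [hp, ← Algebra.smul_def, map_smul]
    exact ⟨b.repr c j, by simp⟩
  · intro h
    choose c hc using h
    refine ⟨∑ j, c j • b j, ?_⟩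
    rw [hp, ← Algebra.smul_def, Finset.smul_sum]
    conv_lhs => rw [← b.sum_repr x]
    refine Finset.sum_congr rfl fun j _ => ?_
    rw [hc, smul_smul]

theorem ofCoords_eq_red (b : Fin d → O) (a : Fin d → ℕ) :
    ofCoords p lam b a = red p lam (∑ j, (a j : O) * b j) := by
  simp [ofCoords, map_sum]

theorem red_eq_red_iff {O : Type*} [CommRing O] (x y : O) :
    red p lam x = red p lam y ↔ (p : O) ^ lam ∣ x - y := by
  rw [Ideal.Quotient.eq, Ideal.mem_span_singleton]

theorem ofCoords_eq_iff (a a' : Fin d → ℕ) :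
    ofCoords p lam b a = ofCoords p lam b a' ↔ ∀ j, a j ≡ a' j [MOD p ^ lam] := by
  rw [ofCoords_eq_red, ofCoords_eq_red, red_eq_red_iff, pow_dvd_iff_repr b]
  refine forall_congr' fun j => ?_
  rw [← padicInt_pow_dvd_natCast_sub_iff (p := p)]
  have h : ∀ a : Fin d → ℕ, b.repr (∑ i, (a i : O) * b i) j = a j := by
    intro a
    have : ∑ i, (a i : O) * b i = ∑ i, (a i : ℤ_[p]) • b i := by
      simp [Algebra.smul_def]
    rw [this, b.repr_sum_self]
  rw [map_sub, Finsupp.sub_apply, h, h]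

theorem exists_ofCoords_eq (x : ModPow O p lam) :
    ∃ a : Fin d → ℕ, (∀ j, a j < p ^ lam) ∧ ofCoords p lam b a = x := by
  obtain ⟨x, rfl⟩ := Ideal.Quotient.mk_surjective x
  refine ⟨fun j => (b.repr x j).appr lam, fun j => PadicInt.appr_lt _ _, ?_⟩
  rw [ofCoords_eq_red]
  refine (red_eq_red_iff _ _).2 ?_
  rw [← dvd_neg, neg_sub, pow_dvd_iff_repr b]
  intro j
  have h : ∑ i, (((b.repr x i).appr lam : ℕ) : O) * b i
      = ∑ i, (((b.repr x i).appr lam : ℕ) : ℤ_[p]) • b i := by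
    simp [Algebra.smul_def]
  rw [h, map_sub, Finsupp.sub_apply, b.repr_sum_self, ← Ideal.mem_span_singleton]
  exact PadicInt.appr_spec lam _

theorem natCast_mul_ofCoords (b : Fin d → O) (m : ℕ) (a : Fin d → ℕ) :
    (m : ModPow O p lam) * ofCoords p lam b a = ofCoords p lam b fun j => m * a j := by
  simp [ofCoords, Finset.mul_sum, mul_assoc]

theorem natCast_modEq {m m' : ℕ} (h : m ≡ m' [MOD p ^ lam]) :
    (m : ModPow O p lam) = m' := by
  have h1 := (red_eq_red_iff (p := p) (lam := lam) (m : O) m').2 (by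
    have := (padicInt_pow_dvd_natCast_sub_iff (p := p) m m').2 h
    have := map_dvd (algebraMap ℤ_[p] O) this
    simpa using this)
  simpa using h1

/-- The division of `a` by `m = p ^ v * m'` reduces to an exact division by `p ^ v` of the
coordinates of `a / m'`. -/
theorem fixedDiv_eq {v m' s : ℕ} (hv : v ≤ lam) (hs : s * m' ≡ 1 [MOD p ^ lam])
    {a : ModPow O p lam} {β : Fin d → ℕ} (hβ : ∀ j, β j < p ^ lam)
    (ha : (s : ModPow O p lam) * a = ofCoords p lam b β) :
    fixedDiv p lam b a (p ^ v * m') =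
      if ∀ j, p ^ v ∣ β j then some (ofCoords p lam b fun j => β j / p ^ v) else none := by
  have hp : 0 < p := (Fact.out : p.Prime).pos
  have hsm : (s : ModPow O p lam) * (m' : ModPow O p lam) = 1 := by
    have := natCast_modEq (O := O) hs
    simpa using this
  -- Multiplying by `s` turns the equation into independent congruences, one for each coordinate.
  have key : ∀ c : Fin d → ℕ,
      ((p ^ v * m' : ℕ) : ModPow O p lam) * ofCoords p lam b c = a ↔
        ∀ j, p ^ v * c j ≡ β j [MOD p ^ lam] := by
    intro c
    rw [← ofCoords_eq_iff b, ← natCast_mul_ofCoords, ← ha]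
    constructor
    · rintro rfl
      push_cast
      linear_combination -((p : ModPow O p lam) ^ v * ofCoords p lam b c) * hsm
    · intro h
      push_cast at h ⊢
      linear_combination (m' : ModPow O p lam) * h + a * hsm
  have hdvd : p ^ v ∣ p ^ lam := pow_dvd_pow p hv
  have hpv : 0 < p ^ v := by positivity
  unfold fixedDiv
  by_cases hd : ∀ j, p ^ v ∣ β j
  · have hsol : ∀ j, p ^ v * (β j / p ^ v) ≡ β j [MOD p ^ lam] := fun j => by
      rw [Nat.mul_div_cancel' (hd j)]
    rw [if_pos ⟨_, (key _).2 hsol⟩, if_pos hd]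
    congr 2
    ext j
    refine le_antisymm (Nat.sInf_le ⟨_, (key _).2 hsol, rfl⟩)
      (le_csInf ⟨_, _, (key _).2 hsol, rfl⟩ ?_)
    rintro k ⟨c, hc, rfl⟩
    apply Nat.div_le_of_le_mul
    have h1 := (key c).1 hc j
    rw [Nat.ModEq, Nat.mod_eq_of_lt (hβ j)] at h1
    rw [← h1]
    exact Nat.mod_le _ _
  · rw [if_neg hd, if_neg]
    rintro ⟨c, hc⟩
    refine hd fun j => ?_
    have h1 := ((key c).1 hc j).of_dvd hdvd
    exact (Nat.modEq_zero_iff_dvd).1 (h1.symm.trans ((Nat.modEq_zero_iff_dvd).2 ⟨_, rfl⟩))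

variable (p lam) in
theorem exists_eq_pow_padicValNat_mul {m : ℕ} (hm : m ≠ 0) :
    ∃ m' s, m = p ^ padicValNat p m * m' ∧ s * m' ≡ 1 [MOD p ^ lam] := by
  obtain ⟨m', hm'⟩ := pow_padicValNat_dvd (p := p) (n := m)
  have hn : ¬ p ∣ m' := by
    rintro ⟨c, rfl⟩
    refine pow_succ_padicValNat_not_dvd (p := p) hm ⟨c, ?_⟩
    conv_lhs => rw [hm']
    ring
  have hc : Nat.Coprime m' (p ^ lam) :=
    (((Fact.out : p.Prime).coprime_iff_not_dvd.2 hn).symm).pow_right _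
  refine ⟨m', (m' : ZMod (p ^ lam))⁻¹.val, hm', ?_⟩
  have : NeZero (p ^ lam) := ⟨pow_ne_zero _ (Fact.out : p.Prime).ne_zero⟩
  rw [← ZMod.natCast_eq_natCast_iff]
  push_cast
  rw [ZMod.natCast_val, ZMod.cast_id, mul_comm, ZMod.coe_mul_inv_eq_one _ hc]

theorem fixedDiv_isSome_iff (a : ModPow O p lam) (m : ℕ) :
    (fixedDiv p lam b a m).isSome ↔ ∃ c, (m : ModPow O p lam) * c = a := by
  unfold fixedDiv
  constructor
  · intro h
    split_ifs at h with h1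
    · obtain ⟨c, hc⟩ := h1
      exact ⟨_, hc⟩
    · simp at h
  · rintro ⟨c, hc⟩
    obtain ⟨γ, -, rfl⟩ := exists_ofCoords_eq b c
    rw [if_pos ⟨γ, hc⟩]
    rfl

/-- Since the coordinates are independent, the minimum taken coordinate by coordinate is itself a
solution. -/
theorem mul_fixedDiv {a c : ModPow O p lam} {m : ℕ} (hm : m ≠ 0) (hv : padicValNat p m ≤ lam)
    (h : fixedDiv p lam b a m = some c) : (m : ModPow O p lam) * c = a := by
  obtain ⟨m', s, hm', hs⟩ := exists_eq_pow_padicValNat_mul p lam hm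
  set v := padicValNat p m
  obtain ⟨β, hβ, hβa⟩ := exists_ofCoords_eq b ((s : ModPow O p lam) * a)
  rw [hm', fixedDiv_eq b hv hs hβ hβa.symm] at h
  split_ifs at h with hd
  obtain rfl := Option.some_injective _ h
  have hsm := natCast_modEq (O := O) hs
  rw [hm', mul_comm (p ^ v), Nat.cast_mul, mul_assoc, natCast_mul_ofCoords]
  simp only [fun j => Nat.mul_div_cancel' (hd j)]
  rw [hβa]
  push_cast at hsm
  linear_combination a * hsm

/-- Minimality matters here: `m * c = 0` may have nonzero solutions, which would spoil the order of
vanishing of a primitive. -/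
theorem fixedDiv_zero (m : ℕ) : fixedDiv p lam b 0 m = some 0 := by
  have h0 : ∀ j : Fin d, (0 : ℕ) ∈ {k : ℕ | ∃ c : Fin d → ℕ,
      (m : ModPow O p lam) * ofCoords p lam b c = 0 ∧ c j = k} :=
    fun j => ⟨0, by simp [ofCoords], rfl⟩
  unfold fixedDiv
  rw [if_pos ⟨0, by simp [ofCoords]⟩]
  simp only [fun j => Nat.sInf_eq_zero.2 (Or.inl (h0 j))]
  simp [ofCoords]

end Coordinates

/-! ### Perturbation of solutions over `O` -/

section Perturbation

variable {p : ℕ} [Fact p.Prime]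

theorem isUnit_natCast_of_not_dvd {S : Type*} [CommRing S] [Algebra ℤ_[p] S] {m : ℕ}
    (h : ¬ p ∣ m) : IsUnit (m : S) := by
  have h1 : IsUnit (m : ℤ_[p]) := by
    rw [PadicInt.isUnit_iff]
    refine le_antisymm (PadicInt.norm_le_one _) (not_lt.1 fun hlt => h ?_)
    have := (PadicInt.norm_int_lt_one_iff_dvd (p := p) (m : ℤ)).1 (by simpa using hlt)
    exact_mod_cast this
  simpa using h1.map (algebraMap ℤ_[p] S)

theorem natCast_mul_pow_dvd_pow {S : Type*} [CommRing S] [Algebra ℤ_[p] S] {m k lam : ℕ}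
    (hm : m ≠ 0) (h : padicValNat p m + k ≤ lam) : (m : S) * (p : S) ^ k ∣ (p : S) ^ lam := by
  obtain ⟨m', s, hm', hs⟩ := exists_eq_pow_padicValNat_mul p 1 hm
  have hu : IsUnit (m' : S) := by
    refine isUnit_natCast_of_not_dvd (p := p) fun hd => ?_
    have h1 := (hs.of_dvd (by simp : p ∣ p ^ 1))
    have h2 := (Nat.modEq_zero_iff_dvd.2 (Dvd.dvd.mul_left hd s)).symm.trans h1
    have := (Nat.modEq_iff_dvd' (Nat.zero_le 1)).1 h2
    exact (Fact.out : p.Prime).one_lt.ne' (Nat.dvd_one.1 this)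
  have h3 : (m : S) * (p : S) ^ k = (p : S) ^ (padicValNat p m + k) * m' := by
    conv_lhs => rw [hm']
    push_cast
    ring
  rw [h3, hu.mul_right_dvd]
  exact pow_dvd_pow _ h

/-- Each `p`th power gains a factor `p`, and the prime-to-`p` part of `N` is a unit. This is the
only estimate needed for the series `∫ 1/h` with its denominators. -/
theorem natCast_mul_dvd_pow_sub_pow {S : Type*} [CommRing S] [Algebra ℤ_[p] S] {k : ℕ}
    (hk : 0 < k) {x y : S} (h : (p : S) ^ k ∣ x - y) {N : ℕ} (hN : N ≠ 0) :
    (N : S) * (p : S) ^ k ∣ x ^ N - y ^ N := by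
  have h1 : ∀ v : ℕ, (p : S) ^ (v + k) ∣ x ^ p ^ v - y ^ p ^ v := by
    intro v
    induction v with
    | zero => simpa using h
    | succ v ih =>
      -- The new difference is the old one times a sum of `p` terms that are congruent to each other
      -- modulo `p`, so one more factor `p` appears.
      rw [pow_succ p v, pow_mul, pow_mul, ← (Commute.all _ _).mul_geom_sum₂,
        show v + 1 + k = (v + k) + 1 by ring, pow_succ]
      exact mul_dvd_mul ih
        (dvd_geom_sum₂_self ((dvd_pow_self _ (by omega)).trans ih))
  obtain ⟨m', hm'⟩ := pow_padicValNat_dvd (p := p) (n := N)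
  set v := padicValNat p N
  have h2 : (p : S) ^ (v + k) ∣ x ^ N - y ^ N := by
    rw [hm', pow_mul, pow_mul]
    exact (h1 v).trans (sub_dvd_pow_sub_pow _ _ _)
  exact (natCast_mul_pow_dvd_pow (p := p) hN le_rfl).trans h2

variable {O : Type*} [CommRing O]

/-- Both sides are the coefficient of `t^j` in the derivative of `z^(i+1)`. -/
theorem mul_coeff_pow_mul_derivative (z : O⟦X⟧) (i j : ℕ) :
    ((i + 1 : ℕ) : O) * coeff j (z ^ i * d⁄dX O z) = ((j + 1 : ℕ) : O) * coeff (j + 1) (z ^ (i + 1)) := by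
  have h := coeff_derivative (z ^ (i + 1)) j
  rw [Derivation.leibniz_pow] at h
  rw [mul_comm ((j + 1 : ℕ) : O)]
  push_cast
  rw [← h, map_nsmul]
  simp

/-- Termwise control of the difference of `a(z) * z'` and `a(y) * y'`. -/
theorem dvd_coeff_aeval_mul_derivative_sub [IsDomain O] [CharZero O] {y z : O⟦X⟧} {c : O} {j : ℕ}
    (h : ∀ N : ℕ, N ≠ 0 → (N : O) * c ∣ coeff (j + 1) (z ^ N - y ^ N)) (a : Polynomial O) :
    ((j + 1 : ℕ) : O) * c ∣
      coeff j (Polynomial.aeval z a * d⁄dX O z - Polynomial.aeval y a * d⁄dX O y) := by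
  induction a using Polynomial.induction_on' with
  | add q r hq hr =>
    have := dvd_add hq hr
    convert this using 1
    rw [← map_add]
    congr 1
    simp only [map_add]
    ring
  | monomial i r =>
    obtain ⟨e, he⟩ := h (i + 1) i.succ_ne_zero
    refine ⟨r * e, ?_⟩
    have hi : ((i + 1 : ℕ) : O) ≠ 0 := Nat.cast_ne_zero.2 i.succ_ne_zero
    -- The denominator `i + 1` in the primitive of `r X^i` is cancelled by the factor `N = i + 1` in
    -- `he`.
    apply mul_left_cancel₀ hi
    have h1 := mul_coeff_pow_mul_derivative z i j
    have h2 := mul_coeff_pow_mul_derivative y i j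
    have h3 : ∀ x : O⟦X⟧, coeff j (Polynomial.aeval x (Polynomial.monomial i r) * d⁄dX O x)
        = r * coeff j (x ^ i * d⁄dX O x) := by
      intro x
      rw [Polynomial.aeval_monomial, mul_assoc, ← Algebra.smul_def, coeff_smul, smul_eq_mul]
    rw [map_sub, h3, h3]
    rw [map_sub] at he
    linear_combination r * h1 - r * h2 + ((j + 1 : ℕ) : O) * r * he

theorem sub_dvd_aeval_sub_aeval {S : Type*} [CommRing S] [Algebra O S] (x y : S)
    (a : Polynomial O) : x - y ∣ Polynomial.aeval x a - Polynomial.aeval y a := by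
  rw [Polynomial.aeval_def, Polynomial.aeval_def, Polynomial.eval₂_eq_eval_map,
    Polynomial.eval₂_eq_eval_map]
  exact Polynomial.sub_dvd_eval_sub _ _ _

theorem constantCoeff_aeval {z : O⟦X⟧} (hz : constantCoeff z = 0) (a : Polynomial O) :
    constantCoeff (Polynomial.aeval z a) = a.coeff 0 := by
  rw [Polynomial.aeval_def, Polynomial.hom_eval₂, hz, Polynomial.eval₂_at_zero]
  simp

/-- Separates the error that is small `p`-adically from the one that is small `t`-adically. As `α`
has degree below `m`, the coefficient of `t^m` in `z - y` is the constant term of `β`. -/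
theorem exists_eq_add_X_pow_mul (q : O) {m : ℕ} {y z : O⟦X⟧}
    (h : ∀ i < m, q ∣ coeff i (z - y)) :
    ∃ α β : O⟦X⟧, (∀ i, m ≤ i → coeff i α = 0) ∧ z = y + q • α + X ^ m * β := by
  choose α hα using h
  set A : O⟦X⟧ := PowerSeries.mk fun i => if hi : i < m then α i hi else 0 with hA
  obtain ⟨β, hβ⟩ : (X : O⟦X⟧) ^ m ∣ z - y - q • A := by
    rw [X_pow_dvd_iff]
    intro i hi
    rw [map_sub, hα i hi, coeff_smul, hA, coeff_mk, dif_pos hi, smul_eq_mul, sub_self]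
  refine ⟨A, β, fun i hi => ?_, by linear_combination hβ⟩
  rw [hA, coeff_mk, dif_neg (by omega)]

variable [Algebra ℤ_[p] O] [IsDomain O] [CharZero O]

theorem natCast_mul_pow_dvd_coeff_pow_sub_pow {y z : O⟦X⟧} {k : ℕ} (hk : 0 < k) {α : O⟦X⟧}
    (h : z = y + ((p : O) ^ k) • α) {N : ℕ} (hN : N ≠ 0) (j : ℕ) :
    (N : O) * (p : O) ^ k ∣ coeff j (z ^ N - y ^ N) := by
  have h1 : (p : O⟦X⟧) ^ k ∣ z - y := by
    refine ⟨α, ?_⟩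
    rw [h, Algebra.smul_def]
    simp
  obtain ⟨γ, hγ⟩ := natCast_mul_dvd_pow_sub_pow (p := p) hk h1 hN
  refine ⟨coeff j γ, ?_⟩
  rw [hγ, ← smul_eq_mul _ (coeff j γ), ← coeff_smul, Algebra.smul_def]
  simp

/-- If `z` and `y` agree modulo `(p ^ k, t ^ m)`, then `a(z) * z' - a(y) * y'` has a primitive over
`O` modulo `t ^ (2 * m)`. -/
theorem natCast_dvd_coeff_aeval_mul_derivative_sub {y z : O⟦X⟧} {k m : ℕ} (hk : 0 < k)
    (h : ∀ i < m, (p : O) ^ k ∣ coeff i (z - y)) (a : Polynomial O) {j : ℕ} (hj : j + 1 < 2 * m) :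
    ((j + 1 : ℕ) : O) ∣
      coeff j (Polynomial.aeval z a * d⁄dX O z - Polynomial.aeval y a * d⁄dX O y) := by
  obtain ⟨α, β, -, hz⟩ := exists_eq_add_X_pow_mul _ h
  rw [← mul_one ((j + 1 : ℕ) : O)]
  refine dvd_coeff_aeval_mul_derivative_sub (fun N hN => ?_) a
  rw [mul_one]
  obtain ⟨γ, hγ⟩ := Polynomial.powAddExpansion (y + ((p : O) ^ k) • α) (X ^ m * β) N
  have h1 : (N : O) ∣ coeff (j + 1) ((y + ((p : O) ^ k) • α) ^ N - y ^ N) :=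
    (dvd_mul_right _ _).trans
      (natCast_mul_pow_dvd_coeff_pow_sub_pow (p := p) hk rfl hN (j + 1))
  -- In the expansion around `y + p^k α` the linear term carries the factor `N`, and the quadratic
  -- one has order at least `2 * m`, beyond `j + 1`.
  have h2 : z ^ N - y ^ N = ((y + ((p : O) ^ k) • α) ^ N - y ^ N)
      + (N : O) • ((y + ((p : O) ^ k) • α) ^ (N - 1) * (X ^ m * β)) + X ^ (2 * m) * (γ * β ^ 2) := by
    rw [hz, hγ, Algebra.smul_def (N : O), map_natCast]
    ring
  rw [h2, map_add, map_add, coeff_smul, coeff_X_pow_mul', if_neg (by omega), add_zero]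
  exact dvd_add h1 (dvd_mul_right _ _)

/-- Stability of the solutions of `a(y) * y' = g` under perturbations of `g`. -/
theorem pow_dvd_coeff_sub_of_pow_dvd {y z : O⟦X⟧} {k m lam : ℕ} (hk : 0 < k)
    (hy : constantCoeff y = 0) (hz : constantCoeff z = 0)
    (hlam : ∀ j, j ≠ 0 → j ≤ m → padicValNat p j + k ≤ lam) {a : Polynomial O} (ha : a.coeff 0 = 1)
    (h : ∀ j < m, (p : O) ^ lam ∣
      coeff j (Polynomial.aeval z a * d⁄dX O z - Polynomial.aeval y a * d⁄dX O y)) :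
    ∀ j ≤ m, (p : O) ^ k ∣ coeff j (z - y) := by
  intro j
  induction j using Nat.strong_induction_on with
  | _ j ih =>
    intro hj
    rcases j with _ | j
    · simp [hy, hz]
    obtain ⟨α, β, hα, hzα⟩ := exists_eq_add_X_pow_mul ((p : O) ^ k) (m := j + 1)
      fun i hi => ih i hi (by omega)
    -- `z₀` keeps the part of the error already known to be divisible by `p^k`; what remains to be
    -- bounded is `β(0)`.
    set z₀ := y + ((p : O) ^ k) • α with hz₀
    have hz₀0 : constantCoeff z₀ = 0 := by
      have := congrArg constantCoeff hzα
      simpa [hz] using this.symm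
    have h1 : ((j + 1 : ℕ) : O) * (p : O) ^ k ∣
        coeff j (Polynomial.aeval z₀ a * d⁄dX O z₀ - Polynomial.aeval y a * d⁄dX O y) :=
      dvd_coeff_aeval_mul_derivative_sub
        (fun N hN => natCast_mul_pow_dvd_coeff_pow_sub_pow (p := p) hk hz₀ hN _) a
    -- `(j + 1) p^k` divides `p^lam`: the excess precision pays for the division by `j + 1`.
    have h2 := (natCast_mul_pow_dvd_pow (p := p) (S := O) j.succ_ne_zero
      (hlam _ j.succ_ne_zero hj)).trans (h j (by omega))
    obtain ⟨γ, hγ⟩ : X ^ (j + 1) ∣ Polynomial.aeval z a - Polynomial.aeval z₀ a := by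
      refine Dvd.dvd.trans ⟨β, ?_⟩ (sub_dvd_aeval_sub_aeval z z₀ a)
      rw [hzα, add_sub_cancel_left]
    -- In degree `j` only the derivative of `t^(j+1) β` contributes, and `a(z₀)` has constant term
    -- `1`.
    have h3 : coeff j (Polynomial.aeval z a * d⁄dX O z - Polynomial.aeval z₀ a * d⁄dX O z₀)
        = ((j + 1 : ℕ) : O) * coeff 0 β := by
      have e1 : Polynomial.aeval z a * d⁄dX O z - Polynomial.aeval z₀ a * d⁄dX O z₀
          = X ^ (j + 1) * (γ * d⁄dX O z + Polynomial.aeval z₀ a * d⁄dX O β)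
            + X ^ j * ((j + 1 : ℕ) • (Polynomial.aeval z₀ a * β)) := by
        have e2 : d⁄dX O z = d⁄dX O z₀ + (X ^ (j + 1) * d⁄dX O β + (j + 1 : ℕ) • (X ^ j * β)) := by
          conv_lhs => rw [hzα]
          rw [map_add, Derivation.leibniz, Derivation.leibniz_pow, derivative_X]
          simp
          ring
        simp only [nsmul_eq_mul] at e2 ⊢
        linear_combination hγ * d⁄dX O z + Polynomial.aeval z₀ a * e2
      have e3 : constantCoeff (Polynomial.aeval z₀ a) = 1 := by
        rw [constantCoeff_aeval hz₀0, ha]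
      rw [e1, map_add, coeff_X_pow_mul', if_neg (by omega), zero_add, coeff_X_pow_mul',
        if_pos le_rfl]
      simp [e3]
    have h4 : ((j + 1 : ℕ) : O) * (p : O) ^ k ∣ ((j + 1 : ℕ) : O) * coeff 0 β := by
      rw [← h3]
      have := dvd_sub h2 h1
      rw [← map_sub] at this
      convert this using 2
      ring
    have h5 := (mul_dvd_mul_iff_left (Nat.cast_ne_zero.2 j.succ_ne_zero)).1 h4
    rw [hzα, hz₀, add_sub_right_comm, add_sub_cancel_left, map_add, coeff_smul,
      hα _ le_rfl, smul_zero, zero_add, coeff_X_pow_mul', if_pos le_rfl, Nat.sub_self]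
    exact h5

end Perturbation

/-! ### Correctness of the algorithm -/

section Newton

variable {R : Type*} [CommRing R]

theorem derivative_aeval (u : R⟦X⟧) (h : Polynomial R) :
    d⁄dX R (Polynomial.aeval u h) = Polynomial.aeval u (Polynomial.derivative h) * d⁄dX R u := by
  rw [Derivation.comp_aeval_eq (a := u) (PowerSeries.derivative R) h, smul_eq_mul]

theorem exists_aeval_add_eq (h : Polynomial R) (u δ : R⟦X⟧) :
    ∃ q, Polynomial.aeval (u + δ) h = Polynomial.aeval u h
      + Polynomial.aeval u (Polynomial.derivative h) * δ + q * δ ^ 2 := by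
  obtain ⟨q, hq⟩ := Polynomial.binomExpansion (h.map (algebraMap R R⟦X⟧)) u δ
  refine ⟨q, ?_⟩
  simpa [Polynomial.aeval_def, Polynomial.eval₂_eq_eval_map, Polynomial.derivative_map] using hq

/-- One Newton iteration doubles the order of the residue. -/
theorem X_pow_dvd_newton {h : Polynomial R} {g u E e v : R⟦X⟧} {k m : ℕ} (hk : k ≤ 2 * m + 1)
    (he : e * Polynomial.aeval u h = d⁄dX R u - g * Polynomial.aeval u h)
    (hem : X ^ m ∣ e) (hE : X ^ (m + 1) ∣ E) (hEe : X ^ k ∣ d⁄dX R E - e)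
    (hv : X ^ (k + 1) ∣ v - (u - Polynomial.aeval u h * E)) :
    X ^ k ∣ d⁄dX R v - g * Polynomial.aeval v h := by
  obtain ⟨r₁, h₁⟩ := hEe
  obtain ⟨r₂, h₂⟩ := hv
  obtain ⟨q, hq⟩ := exists_aeval_add_eq h u (X ^ (k + 1) * r₂ - Polynomial.aeval u h * E)
  have hf := derivative_aeval u h
  set f := Polynomial.aeval u h
  set f₁ := Polynomial.aeval u (Polynomial.derivative h)
  have hvE : v = u + (X ^ (k + 1) * r₂ - f * E) := by linear_combination h₂
  rw [← hvE] at hq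
  have hd : d⁄dX R v = d⁄dX R u - (d⁄dX R f * E + f * d⁄dX R E)
      + X ^ k * ((k + 1 : ℕ) • r₂ + X * d⁄dX R r₂) := by
    rw [hvE, map_add, map_sub, Derivation.leibniz, Derivation.leibniz, Derivation.leibniz_pow,
      derivative_X]
    simp only [smul_eq_mul, nsmul_eq_mul, Nat.add_sub_cancel]
    ring
  -- Up to multiples of `t^k`, the new residue is `f (e - E')` plus multiples of `e E` and of `E^2`.
  have hEe' : X ^ k ∣ e * E := by
    refine (pow_dvd_pow _ hk).trans ?_
    rw [show 2 * m + 1 = m + (m + 1) by ring, pow_add]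
    exact mul_dvd_mul hem hE
  have hEE : X ^ k ∣ E * E := by
    refine (pow_dvd_pow _ (hk.trans (by omega : 2 * m + 1 ≤ (m + 1) + (m + 1)))).trans ?_
    rw [pow_add]
    exact mul_dvd_mul hE hE
  obtain ⟨s, hs⟩ := hEe'
  obtain ⟨s', hs'⟩ := hEE
  have hX : (X : R⟦X⟧) ^ (k + 1) = X ^ k * X := pow_succ _ _
  rw [hX] at hq
  refine ⟨-f * r₁ + ((k + 1 : ℕ) • r₂ + X * d⁄dX R r₂) - f₁ * f * s - g * f₁ * X * r₂
    - g * q * (X ^ k * X ^ 2 * r₂ ^ 2 - 2 * X * r₂ * f * E + f ^ 2 * s'), ?_⟩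
  rw [hd, hq, hf]
  linear_combination (-f) * h₁ - he + f₁ * E * he - f₁ * f * hs - g * q * f ^ 2 * hs'

theorem coe_comp_eq_aeval (h u : Polynomial R) :
    ((h.comp u : Polynomial R) : R⟦X⟧) = Polynomial.aeval (u : R⟦X⟧) h := by
  rw [Polynomial.comp, ← Polynomial.coeToPowerSeries.ringHom_apply, Polynomial.hom_eval₂,
    Polynomial.aeval_def]
  congr 1
  ext r
  simp

theorem X_pow_dvd_sub_trunc (f : R⟦X⟧) (n : ℕ) : X ^ n ∣ f - ((trunc n f : Polynomial R) : R⟦X⟧) := by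
  rw [X_pow_dvd_iff]
  intro i hi
  simp [coeff_trunc, hi]

/-- The truncations are inverse to each other modulo `X^n` as polynomials, and substituting a series
without constant term preserves the order. Truncating `h` and `1/h` keeps all later sums finite. -/
theorem X_pow_dvd_aeval_trunc_mul_sub_one (h : R⟦X⟧) (hh : constantCoeff h = 1) (n : ℕ) {z : R⟦X⟧}
    (hz : constantCoeff z = 0) :
    X ^ n ∣ Polynomial.aeval z (trunc n h) * Polynomial.aeval z (trunc n (invOfUnit h 1)) - 1 := by
  have h1 : (Polynomial.X : Polynomial R) ^ n ∣ trunc n h * trunc n (invOfUnit h 1) - 1 := by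
    rw [Polynomial.X_pow_dvd_iff]
    intro i hi
    have h2 := congrArg (fun f => coeff i f) (mul_invOfUnit h 1 (by simpa using hh))
    have h3 : coeff i (((trunc n h * trunc n (invOfUnit h 1) - 1 : Polynomial R)) : R⟦X⟧) = 0 := by
      rw [Polynomial.coe_sub, Polynomial.coe_mul, map_sub, coeff_mul]
      simp only [Polynomial.coe_one, ← h2, coeff_mul]
      rw [sub_eq_zero]
      refine Finset.sum_congr rfl fun x hx => ?_
      have := Finset.HasAntidiagonal.mem_antidiagonal.1 hx
      simp [coeff_trunc, show x.1 < n by omega, show x.2 < n by omega]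
    rwa [Polynomial.coeff_coe] at h3
  obtain ⟨q, hq⟩ := h1
  obtain ⟨w, rfl⟩ := X_dvd_iff.2 hz
  have := congrArg (Polynomial.aeval (X * w)) hq
  simp only [map_sub, map_mul, map_one, map_pow, Polynomial.aeval_X] at this
  rw [this, mul_pow]
  exact ⟨_, mul_assoc _ _ _⟩

theorem map_aeval {S : Type*} [CommRing S] (φ : R →+* S) (z : R⟦X⟧) (a : Polynomial R) :
    PowerSeries.map φ (Polynomial.aeval z a) = Polynomial.aeval (PowerSeries.map φ z) (a.map φ) := by
  rw [Polynomial.aeval_def, Polynomial.hom_eval₂, Polynomial.aeval_def, Polynomial.eval₂_map]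
  congr 1
  ext r
  simp

theorem map_derivative {S : Type*} [CommRing S] (φ : R →+* S) (z : R⟦X⟧) :
    PowerSeries.map φ (d⁄dX R z) = d⁄dX S (PowerSeries.map φ z) := by
  ext i
  simp [coeff_derivative]

end Newton

/-! ### Success and failure of integration at fixed precision -/

section FixedPrimitive

variable {p : ℕ} {O : Type*} [CommRing O] {d : ℕ} (b : Fin d → O) {lam : ℕ}

theorem fixedPrimitive_eq_some_iff {n : ℕ} {e : (ModPow O p lam)⟦X⟧}
    {E : Polynomial (ModPow O p lam)} :
    fixedPrimitive p lam b n e = some E ↔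
      (∀ i < n, fixedDiv p lam b (coeff i e) (i + 1) = some (E.coeff (i + 1))) ∧ E.coeff 0 = 0 ∧
        ∀ i, n < i → E.coeff i = 0 := by
  have hc : ∀ i, (∑ i ∈ Finset.range n, Polynomial.monomial (i + 1)
      ((fixedDiv p lam b (coeff i e) (i + 1)).getD 0)).coeff i =
      if i ≠ 0 ∧ i ≤ n then (fixedDiv p lam b (coeff (i - 1) e) (i - 1 + 1)).getD 0 else 0 := by
    intro i
    rw [Polynomial.finsetSum_coeff]
    simp only [Polynomial.coeff_monomial]
    rcases i with _ | i
    · simp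
    · simp
  unfold fixedPrimitive
  constructor
  · intro h
    split_ifs at h with hs
    obtain rfl := Option.some_injective _ h
    refine ⟨fun i hi => ?_, by simp [hc], fun i hi => by simp [hc, hi.not_ge]⟩
    obtain ⟨c, hc'⟩ := Option.isSome_iff_exists.1 (hs i hi)
    rw [hc, if_pos ⟨by omega, by omega⟩, Nat.add_sub_cancel, hc']
    rfl
  · rintro ⟨h1, h2, h3⟩
    rw [if_pos fun i hi => by simp [h1 i hi]]
    congr 1
    ext i
    rw [hc]
    rcases i with _ | i
    · simp [h2]
    · by_cases hi : i < n
      · simp [h1 i hi, Nat.succ_le_iff.2 hi]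
      · rw [h3 _ (by omega), if_neg (by omega)]

theorem fixedPrimitive_eq_none_iff {n : ℕ} {e : (ModPow O p lam)⟦X⟧} :
    fixedPrimitive p lam b n e = none ↔
      ∃ i < n, fixedDiv p lam b (coeff i e) (i + 1) = none := by
  unfold fixedPrimitive
  split_ifs with hs
  · simp only [false_iff, not_exists, not_and]
    intro i hi h0
    simpa [h0] using hs i hi
  · simp only [true_iff]
    push Not at hs
    simpa using hs

end FixedPrimitive

/-! ### Backward stability of the algorithm -/

section Correctness

variable {p : ℕ} [Fact p.Prime] {O : Type*} [CommRing O] [Algebra ℤ_[p] O] {d : ℕ}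
  (b : Module.Basis (Fin d) ℤ_[p] O) {lam : ℕ}

/-- The primitive is exact because each quotient solves its equation exactly, and it vanishes to
order `m + 1` because `0` divided by an integer gives `0`. Nothing else about the chosen quotients
matters. -/
theorem fixedPrimitive_spec {n : ℕ} (hlam : ∀ j, j ≠ 0 → j ≤ n → padicValNat p j ≤ lam)
    {e : (ModPow O p lam)⟦X⟧} {E : Polynomial (ModPow O p lam)} {m : ℕ} (hm : X ^ m ∣ e)
    (hmn : m ≤ n) (h : fixedPrimitive p lam b n e = some E) :
    X ^ n ∣ d⁄dX (ModPow O p lam) (E : (ModPow O p lam)⟦X⟧) - e ∧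
      X ^ (m + 1) ∣ (E : (ModPow O p lam)⟦X⟧) := by
  obtain ⟨h1, h2, -⟩ := (fixedPrimitive_eq_some_iff b).1 h
  rw [X_pow_dvd_iff] at hm
  constructor
  · rw [X_pow_dvd_iff]
    intro i hi
    have := mul_fixedDiv b i.succ_ne_zero (hlam _ i.succ_ne_zero hi) (h1 i hi)
    rw [map_sub, coeff_derivative, Polynomial.coeff_coe, ← this, sub_eq_zero]
    push_cast
    ring
  · rw [X_pow_dvd_iff]
    rintro (_ | i) hi
    · simpa using h2
    · have h3 := h1 i (by omega)
      rw [hm i (by omega), fixedDiv_zero] at h3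
      simpa using (Option.some_injective _ h3).symm

variable [IsDomain O] [CharZero O]

set_option maxHeartbeats 1000000 in
/-- The output of the algorithm solves the equation for some `g` with the given reduction modulo
`p ^ lam`. -/
theorem exists_DSol_eq_some {κ n : ℕ} (hκ : 0 < κ) (hκlam : κ ≤ lam)
    (hlam : ∀ j, j ≠ 0 → j ≤ n → padicValNat p j + κ ≤ lam)
    (h g y : O⟦X⟧) (hh : constantCoeff h = 1) (hy0 : constantCoeff y = 0)
    (hy : X ^ n ∣ d⁄dX O y - g * Polynomial.aeval y (trunc n h)) :
    ∃ v : Polynomial (ModPow O p lam),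
      DSol p lam b (trunc n (g.map (red p lam))) (trunc n (h.map (red p lam))) n = some v ∧
      v.natDegree ≤ n ∧ ∀ i ≤ n, ∀ c : O, red p lam c = v.coeff i →
        (p : O) ^ κ ∣ c - coeff i y := by
  set G := trunc n (g.map (red p lam)) with hG
  set H := trunc n (h.map (red p lam)) with hH
  have hHmap : (trunc n h).map (red p lam) = H := by
    ext i
    simp [hH, coeff_trunc, apply_ite (red p lam)]
  set a := trunc n (invOfUnit h 1) with ha
  -- The equation with separated variables, `y' / h(y) = g` modulo `t^n`.
  have hya : X ^ n ∣ Polynomial.aeval y a * d⁄dX O y - g := by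
    have := X_pow_dvd_aeval_trunc_mul_sub_one h hh n hy0
    have h3 := dvd_add (hy.mul_left (Polynomial.aeval y a)) (this.mul_left g)
    convert h3 using 1
    ring
  set e : Polynomial (ModPow O p lam) → (ModPow O p lam)⟦X⟧ := fun v =>
    ((Polynomial.derivative v : Polynomial (ModPow O p lam)) : (ModPow O p lam)⟦X⟧) *
      invOfUnit ((H.comp v : Polynomial (ModPow O p lam)) : (ModPow O p lam)⟦X⟧) 1 -
      (G : (ModPow O p lam)⟦X⟧) with he
  have hmapX : ∀ {w : O⟦X⟧}, X ^ n ∣ w → X ^ n ∣ w.map (red p lam) := fun {w} hw => by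
    simpa using map_dvd (PowerSeries.map (red p lam)) hw
  -- For `n = 0` the truncation `H` is zero, whence the condition.
  have hinv : n ≠ 0 → ∀ v : Polynomial (ModPow O p lam), v.coeff 0 = 0 →
      Polynomial.aeval (v : (ModPow O p lam)⟦X⟧) H *
        invOfUnit ((H.comp v : Polynomial (ModPow O p lam)) : (ModPow O p lam)⟦X⟧) 1 = 1 := by
    intro hn v hv
    rw [coe_comp_eq_aeval]
    refine mul_invOfUnit _ 1 ?_
    rw [constantCoeff_aeval (by simpa using hv), hH, coeff_trunc, if_pos (Nat.pos_of_ne_zero hn)]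
    simp [hh]
  -- the residue of a lift of an approximate solution
  have key : ∀ (v : Polynomial (ModPow O p lam)) (z : O⟦X⟧), constantCoeff z = 0 →
      z.map (red p lam) = v → ∀ j < n,
      red p lam (coeff j (Polynomial.aeval z a * d⁄dX O z - Polynomial.aeval y a * d⁄dX O y)) =
        coeff j (e v) := by
    intro v z hz hzv j hj
    have hv0 : v.coeff 0 = 0 := by
      rw [← Polynomial.coeff_coe, ← hzv]
      simp [hz]
    have h1 := hinv (by omega) v hv0
    set inv := invOfUnit ((H.comp v : Polynomial (ModPow O p lam)) : (ModPow O p lam)⟦X⟧) 1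
    have h2 := hmapX (X_pow_dvd_aeval_trunc_mul_sub_one h hh n hz)
    rw [map_sub, map_mul, map_one, map_aeval, hHmap, hzv] at h2
    have h3 := hmapX hya
    rw [map_sub] at h3
    have h4 := X_pow_dvd_sub_trunc (g.map (red p lam)) n
    have h5 : X ^ n ∣ (Polynomial.aeval z a * d⁄dX O z
        - Polynomial.aeval y a * d⁄dX O y).map (red p lam) - e v := by
      have h6 := dvd_sub (dvd_sub (h2.mul_left (inv * d⁄dX _ (v : (ModPow O p lam)⟦X⟧))) h3) h4
      convert h6 using 1
      rw [map_sub, map_mul, map_derivative, hzv]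
      simp only [he]
      rw [← derivative_coe]
      linear_combination -(PowerSeries.map (red p lam) (Polynomial.aeval z a) *
        d⁄dX _ (v : (ModPow O p lam)⟦X⟧)) * h1
    have h7 := X_pow_dvd_iff.1 h5 j hj
    rwa [map_sub, coeff_map, sub_eq_zero] at h7
  have hlift : ∀ v : Polynomial (ModPow O p lam), v.coeff 0 = 0 →
      ∃ z : O⟦X⟧, constantCoeff z = 0 ∧ z.map (red p lam) = v := by
    intro v hv
    choose r hr using fun i => Ideal.Quotient.mk_surjective (v.coeff i)
    refine ⟨PowerSeries.mk fun i => if i = 0 then 0 else r i, ?_, ?_⟩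
    · rw [← coeff_zero_eq_constantCoeff_apply]
      simp
    · ext i
      rw [coeff_map, coeff_mk, Polynomial.coeff_coe]
      split_ifs with hi
      · rw [hi, hv, map_zero]
      · exact hr i
  -- an approximate solution is the reduction of an exact solution for a perturbation of `g`
  have hstab : ∀ k ≤ n, ∀ (v : Polynomial (ModPow O p lam)) (z : O⟦X⟧), constantCoeff z = 0 →
      z.map (red p lam) = v → X ^ k ∣ e v → ∀ j ≤ k, (p : O) ^ κ ∣ coeff j (z - y) := by
    intro k hk v z hz hzv hev
    rcases Nat.eq_zero_or_pos n with rfl | hn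
    · intro j hj
      obtain rfl : j = 0 := by omega
      simp [hz, hy0]
    refine pow_dvd_coeff_sub_of_pow_dvd (lam := lam) (a := a) hκ hy0 hz
      (fun j hj hjk => hlam j hj (hjk.trans hk)) ?_ fun j hj => ?_
    · rw [ha, coeff_trunc, if_pos hn]
      simp
    · have h1 := key v z hz hzv j (by omega)
      rw [X_pow_dvd_iff.1 hev j hj, ← map_zero (red p lam), red_eq_red_iff, sub_zero] at h1
      exact h1
  have hres : n ≠ 0 → ∀ v : Polynomial (ModPow O p lam), v.coeff 0 = 0 →
      e v * Polynomial.aeval (v : (ModPow O p lam)⟦X⟧) H =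
        d⁄dX (ModPow O p lam) (v : (ModPow O p lam)⟦X⟧)
        - (G : (ModPow O p lam)⟦X⟧) * Polynomial.aeval (v : (ModPow O p lam)⟦X⟧) H := by
    intro hn v hv
    simp only [he]
    rw [← derivative_coe]
    linear_combination d⁄dX (ModPow O p lam) (v : (ModPow O p lam)⟦X⟧) * hinv hn v hv
  have main : ∀ k ≤ n, ∃ v : Polynomial (ModPow O p lam), DSol p lam b G H k = some v ∧
      v.natDegree ≤ k ∧ v.coeff 0 = 0 ∧ X ^ k ∣ e v := by
    intro k
    induction k using Nat.strong_induction_on with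
    | _ k ih =>
      intro hk
      rcases k with _ | k
      · exact ⟨0, by rw [DSol], by simp⟩
      set m := (k + 1) / 2 with hm
      obtain ⟨u, hu, -, hu0, hue⟩ := ih m (by omega) (by omega)
      obtain ⟨z, hz, hzu⟩ := hlift u hu0
      have hs := hstab m (by omega) u z hz hzu hue
      -- The residue lifts to `a(z) z' - a(y) y'`, whose coefficients are divisible over `O` by
      -- `hs`; the quotients over `O` reduce to solutions modulo `p^lam`.
      have hdiv : ∀ i < k + 1, (fixedDiv p lam b (coeff i (e u)) (i + 1)).isSome := by
        intro i hi
        rw [fixedDiv_isSome_iff]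
        obtain ⟨c, hc⟩ := natCast_dvd_coeff_aeval_mul_derivative_sub (m := m + 1) hκ
          (fun j hj => hs j (by omega)) a (j := i) (by omega)
        refine ⟨red p lam c, ?_⟩
        rw [← key u z hz hzu i (by omega), hc]
        simp
      obtain ⟨E, hE⟩ : ∃ E, fixedPrimitive p lam b (k + 1) (e u) = some E := by
        rw [← Option.ne_none_iff_exists', Ne, fixedPrimitive_eq_none_iff]
        rintro ⟨i, hi, h0⟩
        simpa [h0] using hdiv i hi
      obtain ⟨hE1, hE2⟩ := fixedPrimitive_spec b
        (fun j hj hjk => by have := hlam j hj (by omega); omega) hue (by omega) hE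
      set v := trunc (k + 1 + 1) ((u : (ModPow O p lam)⟦X⟧)
        - ((H.comp u : Polynomial (ModPow O p lam)) : (ModPow O p lam)⟦X⟧) * (E : (ModPow O p lam)⟦X⟧)) with hv
      have hv0 : v.coeff 0 = 0 := by
        rw [hv, coeff_trunc, if_pos (by omega), map_sub, coeff_zero_eq_constantCoeff_apply,
          coeff_zero_eq_constantCoeff_apply, map_mul, X_dvd_iff.1 (dvd_of_mul_left_dvd hE2)]
        simpa using hu0
      refine ⟨v, ?_, ?_, hv0, ?_⟩
      · rw [DSol, hu, Option.bind_some, newtonStep, hE]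
        rfl
      · exact Nat.lt_succ_iff.1 (natDegree_trunc_lt _ _)
      · have hn : n ≠ 0 := by omega
        have h1 := X_pow_dvd_newton (k := k + 1) (m := m) (by omega) (hres hn u hu0) hue hE2 hE1
          (v := v) (by
            rw [← coe_comp_eq_aeval, ← dvd_neg, neg_sub]
            exact X_pow_dvd_sub_trunc _ _)
        rw [← hres hn v hv0] at h1
        have h2 := h1.mul_right
          (invOfUnit ((H.comp v : Polynomial (ModPow O p lam)) : (ModPow O p lam)⟦X⟧) 1)
        rwa [mul_assoc, hinv hn v hv0, mul_one] at h2
  obtain ⟨v, hv, hvn, hv0, hve⟩ := main n le_rfl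
  refine ⟨v, hv, hvn, fun i hi c hc => ?_⟩
  obtain ⟨z, hz, hzv⟩ := hlift v hv0
  have h1 := hstab n le_rfl v z hz hzv hve i hi
  have h2 : red p lam c = red p lam (coeff i z) := by
    rw [hc, ← coeff_map, hzv, Polynomial.coeff_coe]
  rw [red_eq_red_iff] at h2
  have h3 := dvd_add ((pow_dvd_pow _ ?_).trans h2) h1
  · rw [map_sub] at h3
    convert h3 using 1
    ring
  · exact hκlam

end Correctness

/-! ### From the solution over `K` to a truncated solution over `O` -/

theorem X_pow_dvd_subst_sub_aeval_trunc {R : Type*} [CommRing R] (h : R⟦X⟧) {y : R⟦X⟧}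
    (hy : constantCoeff y = 0) (n : ℕ) :
    X ^ n ∣ h.subst y - Polynomial.aeval y (trunc n h) := by
  have hs : HasSubst y := HasSubst.of_constantCoeff_zero' hy
  obtain ⟨q, hq⟩ := X_pow_dvd_sub_trunc h n
  have h1 : h.subst y = (((trunc n h : Polynomial R) : R⟦X⟧) + X ^ n * q).subst y := by
    rw [← hq, add_sub_cancel]
  rw [h1, subst_add hs, subst_mul hs, subst_pow hs, subst_X hs, subst_coe hs, add_sub_cancel_left]
  exact (pow_dvd_pow_of_dvd (X_dvd_iff.2 hy) n).mul_right _

/-- Only the coefficients of `Y` up to `t^n` are integral, so `Y` is replaced by its truncation,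
which still solves the equation modulo `t^n`. -/
theorem exists_DSol_eq_some_of_isSolution {p : ℕ} [Fact p.Prime] {K : Type*} [Field K] [CharZero K]
    [Algebra ℤ_[p] K] (O : Subalgebra ℤ_[p] K) {d : ℕ} (b : Module.Basis (Fin d) ℤ_[p] O)
    (h : O⟦X⟧) (hh : constantCoeff h = 1) {n κ lam : ℕ} (hκ : 0 < κ)
    (hlam : Nat.log p n + κ ≤ lam) (g : O⟦X⟧)
    {Y : K⟦X⟧} (hY : IsSolution (h.map (algebraMap O K))
      (g.map (algebraMap O K)) Y)
    (hYi : ∀ i ≤ n, coeff i Y ∈ O) :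
    ∃ v : Polynomial (ModPow O p lam),
      DSol p lam b (trunc n (g.map (red p lam))) (trunc n (h.map (red p lam))) n = some v ∧
      v.natDegree ≤ n ∧
      ∀ i ≤ n, ∀ a c : O, (a : K) = coeff i Y →
        red p lam c = v.coeff i → (p : O) ^ κ ∣ c - a := by
  have : CharZero O := ⟨fun m n hmn => by
    have := congrArg (algebraMap O K) hmn
    simpa using this⟩
  set y : O⟦X⟧ := PowerSeries.mk fun i => if hi : i ≤ n then ⟨coeff i Y, hYi i hi⟩ else 0 with hy
  have hyc : ∀ i ≤ n, algebraMap O K (coeff i y) = coeff i Y := by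
    intro i hi
    rw [hy, coeff_mk, dif_pos hi]
    rfl
  have hy0 : constantCoeff y = 0 := by
    apply FaithfulSMul.algebraMap_injective O K
    rw [← coeff_zero_eq_constantCoeff_apply, hyc 0 (Nat.zero_le _), map_zero,
      coeff_zero_eq_constantCoeff_apply, hY.1]
  have hyY : X ^ (n + 1) ∣ y.map (algebraMap O K) - Y := by
    rw [X_pow_dvd_iff]
    intro i hi
    rw [map_sub, coeff_map, hyc i (by omega), sub_self]
  have hode : X ^ n ∣ d⁄dX O y - g * Polynomial.aeval y (trunc n h) := by
    have h1 := X_pow_dvd_subst_sub_aeval_trunc (h.map (algebraMap O K)) hY.1 n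
    have h2 : X ^ n ∣ Polynomial.aeval (y.map (algebraMap O K)) (trunc n (h.map (algebraMap O K)))
        - Polynomial.aeval Y (trunc n (h.map (algebraMap O K))) :=
      ((pow_dvd_pow _ n.le_succ).trans hyY).trans (sub_dvd_aeval_sub_aeval _ _ _)
    have h3 : X ^ n ∣ d⁄dX K (y.map (algebraMap O K)) - d⁄dX K Y := by
      rw [X_pow_dvd_iff]
      intro i hi
      rw [← map_sub, coeff_derivative, X_pow_dvd_iff.1 hyY _ (by omega), zero_mul]
    have h4 : (trunc n h).map (algebraMap O K) = trunc n (h.map (algebraMap O K)) := by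
      ext i
      simp [coeff_trunc, apply_ite (algebraMap O K)]
    have h5 : X ^ n ∣ (d⁄dX O y - g * Polynomial.aeval y (trunc n h)).map (algebraMap O K) := by
      have h6 := dvd_sub h3 ((h2.sub h1).mul_left (g.map (algebraMap O K)))
      rw [map_sub, map_mul, map_aeval, map_derivative, h4]
      convert h6 using 1
      rw [hY.2]
      ring
    rw [X_pow_dvd_iff] at h5 ⊢
    intro i hi
    apply FaithfulSMul.algebraMap_injective O K
    rw [← coeff_map, h5 i hi, map_zero]
  obtain ⟨v, hv, hvn, hvc⟩ := exists_DSol_eq_some (lam := lam) b hκ (by omega) (fun j hj hjn => by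
    have h1 : padicValNat p j ≤ Nat.log p n :=
      (padicValNat_le_nat_log j).trans (Nat.log_mono_right hjn)
    omega) h g y hh hy0 hode
  refine ⟨v, hv, hvn, fun i hi a c ha hc => ?_⟩
  have : a = coeff i y := by
    apply FaithfulSMul.algebraMap_injective O K
    rw [hyc i hi, ← ha]
    rfl
  rw [this]
  exact hvc i hi c hc

/-! ### Functions computed by small circuits -/

/-- The function `F` on bits is computed by a circuit with at most `s` gates. -/
def HasCost {α β : Type} (F : (α → Bool) → β → Bool) (s : ℕ) : Prop :=
  ∃ c : BoolCircuit α β, c.eval = F ∧ c.size ≤ s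

namespace HasCost

variable {α β γ δ : Type}

theorem mono {F : (α → Bool) → β → Bool} {s t : ℕ} (h : HasCost F s) (hst : s ≤ t) :
    HasCost F t := by
  obtain ⟨c, hc, hs⟩ := h
  exact ⟨c, hc, hs.trans hst⟩

theorem of_circuit (c : BoolCircuit α β) : HasCost c.eval c.size := ⟨c, rfl, le_rfl⟩

theorem wire (f : β → α) : HasCost (fun x j => x (f j)) 0 := ⟨.wire f, rfl, le_rfl⟩

theorem comp {F : (α → Bool) → β → Bool} {G : (β → Bool) → γ → Bool} {s t : ℕ}
    (hG : HasCost G t) (hF : HasCost F s) : HasCost (fun x => G (F x)) (s + t) := by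
  obtain ⟨c, rfl, hs⟩ := hF
  obtain ⟨e, rfl, ht⟩ := hG
  exact ⟨.seq c e, rfl, add_le_add hs ht⟩

/-- Rearranging the outputs is free. -/
theorem select {F : (α → Bool) → β → Bool} {s : ℕ} (hF : HasCost F s) (f : γ → β) :
    HasCost (fun x j => F x (f j)) s :=
  ((wire f).comp hF).mono (by simp)

/-- Rearranging the inputs is free. -/
theorem onInputs {F : (α → Bool) → β → Bool} {s : ℕ} (hF : HasCost F s) (f : α → γ) :
    HasCost (fun x : γ → Bool => F fun i => x (f i)) s :=
  (hF.comp (wire f)).mono (by simp)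

theorem pair {F : (α → Bool) → β → Bool} {G : (α → Bool) → γ → Bool} {s t : ℕ}
    (hF : HasCost F s) (hG : HasCost G t) : HasCost (fun x => Sum.elim (F x) (G x)) (s + t) := by
  obtain ⟨c, rfl, hs⟩ := hF
  obtain ⟨e, rfl, ht⟩ := hG
  refine ⟨.seq (.wire (Sum.elim id id)) (.par c e), ?_, ?_⟩
  · rfl
  · simp only [BoolCircuit.size]
    omega

/-- Sharing an intermediate result. -/
theorem share {F : (α → Bool) → β → Bool} {G : (α ⊕ β → Bool) → γ → Bool} {s t : ℕ}
    (hF : HasCost F s) (hG : HasCost G t) : HasCost (fun x => G (Sum.elim x (F x))) (s + t) :=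
  (hG.comp ((wire id).pair hF)).mono (by simp)

theorem const_unit (c : Bool) : HasCost (fun (_ : α → Bool) (_ : Unit) => c) 0 :=
  ⟨.seq (.wire Empty.elim) (.const c), rfl, le_rfl⟩

theorem family_fin {n : ℕ} {F : Fin n → (α → Bool) → β → Bool} {s : Fin n → ℕ}
    (h : ∀ i, HasCost (F i) (s i)) :
    HasCost (fun x (q : Fin n × β) => F q.1 x q.2) (∑ i, s i) := by
  induction n with
  | zero => exact ⟨.wire fun q => q.1.elim0, by ext x q; exact q.1.elim0, by simp [BoolCircuit.size]⟩
  | succ n ih =>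
    have h1 := ((h 0).pair (ih fun i => h i.succ)).select
      (fun q : Fin (n + 1) × β => Fin.cases (motive := fun _ => β ⊕ Fin n × β)
        (Sum.inl q.2) (fun i => Sum.inr (i, q.2)) q.1)
    rw [Fin.sum_univ_succ]
    convert h1 using 1
    ext x ⟨i, j⟩
    refine Fin.cases ?_ (fun i => ?_) i <;> simp

theorem family {ι : Type} [Fintype ι] {F : ι → (α → Bool) → β → Bool} {s : ι → ℕ}
    (h : ∀ i, HasCost (F i) (s i)) :
    HasCost (fun x (q : ι × β) => F q.1 x q.2) (∑ i, s i) := by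
  let e := Fintype.equivFin ι
  have h1 := (family_fin fun i => h (e.symm i)).select fun q : ι × β => (e q.1, q.2)
  rw [Equiv.sum_comp e.symm] at h1
  convert h1 using 1
  ext x q
  simp

/-- The cost of computing the outputs one by one. -/
theorem bits {β : Type} [Fintype β] {F : (α → Bool) → β → Bool} {s : β → ℕ}
    (h : ∀ j, HasCost (fun x (_ : Unit) => F x j) (s j)) : HasCost F (∑ j, s j) :=
  (family h).select fun j => (j, ())

theorem bits_const {β : Type} [Fintype β] {F : (α → Bool) → β → Bool} {s : ℕ}
    (h : ∀ j, HasCost (fun x (_ : Unit) => F x j) s) : HasCost F (Fintype.card β * s) := by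
  simpa using bits h

theorem bits_zero {β : Type} [Fintype β] {F : (α → Bool) → β → Bool}
    (h : ∀ j, HasCost (fun x (_ : Unit) => F x j) 0) : HasCost F 0 := by
  simpa using bits h

theorem const {β : Type} [Fintype β] (c : β → Bool) : HasCost (fun (_ : α → Bool) => c) 0 :=
  bits_zero fun j => const_unit (c j)

theorem op {f g : (α → Bool) → Bool} {s t : ℕ} (o : Bool → Bool → Bool)
    (hf : HasCost (fun x (_ : Unit) => f x) s) (hg : HasCost (fun x (_ : Unit) => g x) t) :
    HasCost (fun x (_ : Unit) => o (f x) (g x)) (s + t + 1) :=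
  ((of_circuit (.gate o)).comp (hf.pair hg)).mono (by simp [BoolCircuit.size])

theorem bit (i : α) : HasCost (fun x (_ : Unit) => x i) 0 := wire fun _ => i

/-- A gate with one relevant input. -/
theorem op₁ {f : (α → Bool) → Bool} {s : ℕ} (o : Bool → Bool)
    (hf : HasCost (fun x (_ : Unit) => f x) s) :
    HasCost (fun x (_ : Unit) => o (f x)) (s + 1) :=
  hf.op (fun c _ => o c) (const_unit false)

theorem exists_bit {ι : Type} [Fintype ι] {f : ι → (α → Bool) → Bool} {s : ι → ℕ}
    (h : ∀ i, HasCost (fun x (_ : Unit) => f i x) (s i)) :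
    ∃ g : (α → Bool) → Bool, HasCost (fun x (_ : Unit) => g x) (∑ i, (s i + 1)) ∧
      ∀ x, g x = true ↔ ∃ i, f i x = true := by
  have key : ∀ (n : ℕ) (f : Fin n → (α → Bool) → Bool) (s : Fin n → ℕ),
      (∀ i, HasCost (fun x (_ : Unit) => f i x) (s i)) →
      HasCost (fun x (_ : Unit) => decide (∃ i, f i x = true)) (∑ i, (s i + 1)) := by
    intro n
    induction n with
    | zero =>
      intro f s _
      simpa using const_unit (α := α) false
    | succ n ih =>
      intro f s h
      have h1 := (h 0).op or (ih _ _ fun i => h i.succ)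
      rw [Fin.sum_univ_succ, add_right_comm]
      convert h1 using 1
      ext x u
      simp [Fin.exists_fin_succ]
  let e := Fintype.equivFin ι
  have h1 := key _ _ _ fun i => h (e.symm i)
  rw [Equiv.sum_comp e.symm fun i => s i + 1] at h1
  refine ⟨_, h1, fun x => ?_⟩
  rw [decide_eq_true_iff]
  exact (e.exists_congr_left (p := fun i => f i x = true)).symm

end HasCost

/-! ### Gates are needed for inputs that matter -/

/-- Every output of a circuit is an input or depends only on the inputs that are fed into gates. -/
theorem BoolCircuit.exists_gate_inputs {α β : Type} (c : BoolCircuit α β) :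
    ∃ T : Finset α, T.card ≤ 2 * c.size ∧ ∀ j : β,
      (∃ a, ∀ x, c.eval x j = x a) ∨
        ∀ x y : α → Bool, (∀ a ∈ T, x a = y a) → c.eval x j = c.eval y j := by
  classical
  induction c with
  | wire f => exact ⟨∅, by simp, fun j => Or.inl ⟨f j, fun _ => rfl⟩⟩
  | const c => exact ⟨∅, by simp, fun j => Or.inr fun _ _ _ => rfl⟩
  | gate op =>
    refine ⟨Finset.univ, by simp [BoolCircuit.size], fun j => Or.inr fun x y h => ?_⟩
    rw [show x = y from funext fun a => h a (Finset.mem_univ a)]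
  | @seq α β γ s t hs ht =>
    obtain ⟨S, hS, hSj⟩ := hs
    obtain ⟨T, hT, hTj⟩ := ht
    -- Each wire that enters a gate of `t` depends on at most one input beyond those already counted
    -- for `s`, and there are at most `2 * t.size` such wires.
    have hch : ∀ j : β, ∃ A : Finset α, A.card ≤ 1 ∧
        ∀ x y : α → Bool, (∀ a ∈ S ∪ A, x a = y a) → s.eval x j = s.eval y j := by
      intro j
      rcases hSj j with ⟨a, ha⟩ | h
      · refine ⟨{a}, by simp, fun x y h => ?_⟩
        rw [ha, ha]
        exact h a (by simp)
      · exact ⟨∅, by simp, fun x y hxy => h x y fun a ha => hxy a (by simp [ha])⟩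
    choose A hA hAj using hch
    refine ⟨S ∪ T.biUnion A, ?_, fun j => ?_⟩
    · refine (Finset.card_union_le _ _).trans ?_
      have := Finset.card_biUnion_le_card_mul T A 1 fun j _ => hA j
      simp only [BoolCircuit.size]
      omega
    · rcases hTj j with ⟨i, hi⟩ | h
      · rcases hSj i with ⟨a, ha⟩ | h'
        · exact Or.inl ⟨a, fun x => (hi _).trans (ha x)⟩
        · refine Or.inr fun x y hxy => ?_
          simp only [BoolCircuit.eval, hi]
          exact h' x y fun a ha => hxy a (Finset.mem_union_left _ ha)
      · refine Or.inr fun x y hxy => h _ _ fun i hi => hAj i x y fun a ha => hxy a ?_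
        rcases Finset.mem_union.1 ha with h1 | h1
        · exact Finset.mem_union_left _ h1
        · exact Finset.mem_union_right _ (Finset.mem_biUnion.2 ⟨i, hi, h1⟩)
  | @par α β γ δ s t hs ht =>
    obtain ⟨S, hS, hSj⟩ := hs
    obtain ⟨T, hT, hTj⟩ := ht
    refine ⟨S.disjSum T, ?_, fun j => ?_⟩
    · rw [Finset.card_disjSum]
      simp only [BoolCircuit.size]
      omega
    · rcases j with j | j
      · rcases hSj j with ⟨a, ha⟩ | h
        · exact Or.inl ⟨Sum.inl a, fun x => ha _⟩
        · exact Or.inr fun x y hxy => h _ _ fun a ha => hxy _ (Finset.inl_mem_disjSum.2 ha)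
      · rcases hTj j with ⟨a, ha⟩ | h
        · exact Or.inl ⟨Sum.inr a, fun x => ha _⟩
        · exact Or.inr fun x y hxy => h _ _ fun a ha => hxy _ (Finset.inr_mem_disjSum.2 ha)

/-! ### Integers in binary -/

/-- The integer with the given binary digits. -/
def bitVal {L : ℕ} (x : Fin L → Bool) : ℕ := ∑ k : Fin L, if x k then 2 ^ (k : ℕ) else 0

theorem bitVal_succ {L : ℕ} (x : Fin (L + 1) → Bool) :
    bitVal x = (x 0).toNat + 2 * bitVal fun k => x k.succ := by
  simp only [bitVal, Fin.sum_univ_succ, Finset.mul_sum, mul_ite, mul_zero, Fin.val_succ, pow_succ']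
  cases x 0 <;> simp

theorem bitVal_castSucc {L : ℕ} (x : Fin (L + 1) → Bool) :
    bitVal x = (bitVal fun k => x k.castSucc) + 2 ^ L * (x (Fin.last L)).toNat := by
  simp only [bitVal, Fin.sum_univ_castSucc, Fin.val_castSucc, Fin.val_last]
  cases x (Fin.last L) <;> simp

theorem bitVal_lt {L : ℕ} (x : Fin L → Bool) : bitVal x < 2 ^ L := by
  induction L with
  | zero => simp [bitVal]
  | succ L ih =>
    have h1 := ih fun k => x k.succ
    have h2 := (x 0).toNat_le
    rw [bitVal_succ, pow_succ]
    omega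

theorem exists_bitVal_eq {L a : ℕ} (h : a < 2 ^ L) : ∃ x : Fin L → Bool, bitVal x = a := by
  induction L generalizing a with
  | zero => exact ⟨fun _ => false, by simp [bitVal]; omega⟩
  | succ L ih =>
    obtain ⟨x, hx⟩ := ih (a := a / 2) (by rw [pow_succ] at h; omega)
    refine ⟨Fin.cons (decide (a % 2 = 1)) x, ?_⟩
    rw [bitVal_succ]
    simp only [Fin.cons_zero, Fin.cons_succ, hx]
    rcases Nat.mod_two_eq_zero_or_one a with h | h <;> simp [h] <;> omega

theorem bitVal_injective {L : ℕ} : Function.Injective (bitVal : (Fin L → Bool) → ℕ) := by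
  induction L with
  | zero => exact fun x y _ => Subsingleton.elim _ _
  | succ L ih =>
    intro x y h
    rw [bitVal_succ, bitVal_succ] at h
    have h0 : x 0 = y 0 := by
      cases hx : x 0 <;> cases hy : y 0 <;> simp [hx, hy] at h ⊢ <;> omega
    rw [h0] at h
    have h1 := ih (a₁ := fun k => x k.succ) (a₂ := fun k => y k.succ) (by omega)
    ext k
    refine Fin.cases h0 (fun k => congrFun h1 k) k

theorem bitVal_not {L : ℕ} (x : Fin L → Bool) : (bitVal fun k => !x k) + bitVal x + 1 = 2 ^ L := by
  induction L with
  | zero => simp [bitVal]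
  | succ L ih =>
    have := ih fun k => x k.succ
    rw [bitVal_succ, bitVal_succ, pow_succ]
    cases x 0 <;> simp <;> omega

theorem bitVal_false {L : ℕ} : bitVal (fun _ : Fin L => false) = 0 := by simp [bitVal]

variable {α : Type}

/-- The ripple-carry adder. -/
theorem exists_adder {L : ℕ} {A B : (α → Bool) → Fin L → Bool} {C : (α → Bool) → Bool}
    {s t r : ℕ} (hA : HasCost A s) (hB : HasCost B t) (hC : HasCost (fun x (_ : Unit) => C x) r) :
    ∃ F : (α → Bool) → Fin L ⊕ Unit → Bool, HasCost F (s + t + r + 6 * L) ∧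
      ∀ x, (bitVal fun k => F x (Sum.inl k)) + 2 ^ L * (F x (Sum.inr ())).toNat =
        bitVal (A x) + bitVal (B x) + (C x).toNat := by
  have key : ∀ L : ℕ, ∃ F : ((Fin L ⊕ Fin L) ⊕ Unit → Bool) → Fin L ⊕ Unit → Bool,
      HasCost F (6 * L) ∧ ∀ x,
        (bitVal fun k => F x (Sum.inl k)) + 2 ^ L * (F x (Sum.inr ())).toNat =
        (bitVal fun k => x (Sum.inl (Sum.inl k))) + (bitVal fun k => x (Sum.inl (Sum.inr k)))
          + (x (Sum.inr ())).toNat := by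
    intro L
    induction L with
    | zero => exact ⟨fun x => Sum.elim Fin.elim0 fun _ => x (Sum.inr ()),
        (HasCost.wire (Sum.elim (fun k : Fin 0 => k.elim0) fun _ => Sum.inr ())).select id |> fun h => by
          convert h using 1
          ext x (k | k)
          · exact k.elim0
          · rfl, by simp [bitVal]⟩
    | succ L ih =>
      obtain ⟨F, hF, hFv⟩ := ih
      -- the inputs, followed by the sum and the carry of the low parts
      have h1 := hF.onInputs (Sum.map (Sum.map Fin.castSucc Fin.castSucc) id :
        _ → (Fin (L + 1) ⊕ Fin (L + 1)) ⊕ Unit)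
      let ι := ((Fin (L + 1) ⊕ Fin (L + 1)) ⊕ Unit) ⊕ (Fin L ⊕ Unit)
      have ha := HasCost.bit (α := ι) (Sum.inl (Sum.inl (Sum.inl (Fin.last L))))
      have hb := HasCost.bit (α := ι) (Sum.inl (Sum.inl (Sum.inr (Fin.last L))))
      have hc := HasCost.bit (α := ι) (Sum.inr (Sum.inr ()))
      -- A full adder: two gates for the sum and four for the carry, which is the constant `6`.
      have hsum := (ha.op xor hb).op xor hc
      have hcarry := (ha.op and hb).op or (hc.op and (ha.op xor hb))
      have h2 := ((HasCost.wire (α := ι) fun k : Fin L => Sum.inr (Sum.inl k)).pair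
        (hsum.pair hcarry)).select (Sum.elim (Fin.snoc (α := fun _ => Fin L ⊕ (Unit ⊕ Unit)) Sum.inl
          (Sum.inr (Sum.inl ()))) fun _ : Unit => Sum.inr (Sum.inr ()))
      refine ⟨_, (h1.share h2).mono (by omega), fun x => ?_⟩
      have h3 := hFv fun i => x (Sum.map (Sum.map Fin.castSucc Fin.castSucc) id i)
      simp only [Sum.map_inl, Sum.map_inr, id] at h3
      rw [bitVal_castSucc, bitVal_castSucc (fun k => x (Sum.inl (Sum.inl k))),
        bitVal_castSucc (fun k => x (Sum.inl (Sum.inr k)))]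
      simp only [Sum.elim_inl, Sum.elim_inr, Fin.snoc_castSucc, Fin.snoc_last]
      generalize F (fun i => x (Sum.map (Sum.map Fin.castSucc Fin.castSucc) id i)) (Sum.inr ()) = c
        at h3 ⊢
      rw [pow_succ]
      cases x (Sum.inl (Sum.inl (Fin.last L))) <;> cases x (Sum.inl (Sum.inr (Fin.last L))) <;>
        cases c <;> simp at h3 ⊢ <;> omega
  obtain ⟨F, hF, hFv⟩ := key L
  refine ⟨_, (hF.comp ((hA.pair hB).pair hC)).mono (by omega), fun x => ?_⟩
  exact hFv _

/-- Subtraction with comparison: the last output tells whether `A ≥ B`. -/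
theorem exists_subtractor {L : ℕ} {A B : (α → Bool) → Fin L → Bool}
    {s t : ℕ} (hA : HasCost A s) (hB : HasCost B t) :
    ∃ F : (α → Bool) → Fin L ⊕ Unit → Bool, HasCost F (s + t + 7 * L) ∧
      ∀ x, (bitVal fun k => F x (Sum.inl k)) + 2 ^ L * (F x (Sum.inr ())).toNat + bitVal (B x) =
        bitVal (A x) + 2 ^ L := by
  -- Two's complement: `A - B + 2^L = A + (not B) + 1`, and the carry is the comparison.
  have h1 : HasCost (fun x k => !B x k) (t + L) := by
    have : HasCost (fun (x : Fin L → Bool) k => !x k) (Fintype.card (Fin L) * 1) :=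
      HasCost.bits_const fun k => (HasCost.bit k).op₁ not
    exact (this.comp hB).mono (by simp)
  obtain ⟨F, hF, hFv⟩ := exists_adder hA h1 (HasCost.const_unit true)
  refine ⟨F, hF.mono (by omega), fun x => ?_⟩
  have h2 := hFv x
  have h3 := bitVal_not (B x)
  simp only [Bool.toNat_true] at h2
  omega

/-- Subtraction modulo `P`. -/
theorem exists_modSub {L P : ℕ} (hP : P ≤ 2 ^ L) :
    ∃ F : (Fin L ⊕ Fin L → Bool) → Fin L → Bool, HasCost F (14 * L) ∧
      ∀ x y, bitVal x < P → bitVal y < P →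
        bitVal (F (Sum.elim x y)) < P ∧ bitVal (F (Sum.elim x y)) + bitVal y ≡ bitVal x [MOD P] := by
  obtain ⟨F, hF, hFv⟩ := exists_subtractor (HasCost.wire (Sum.inl : Fin L → Fin L ⊕ Fin L))
    (HasCost.wire (Sum.inr : Fin L → Fin L ⊕ Fin L))
  -- The correction to be added after a borrow. For `P = 2^L` it is `0`, since adding `P` has no
  -- effect on `L` bits.
  obtain ⟨m, hm⟩ := exists_bitVal_eq (L := L) (a := P % 2 ^ L) (Nat.mod_lt _ (by positivity))
  have h1 : HasCost (fun (x : Fin L ⊕ Unit → Bool) (k : Fin L) => !x (Sum.inr ()) && m k) L := by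
    have := HasCost.bits_const (F := fun (x : Fin L ⊕ Unit → Bool) (k : Fin L) =>
      !x (Sum.inr ()) && m k) fun k => (HasCost.bit (Sum.inr ())).op₁ fun c => !c && m k
    exact this.mono (by simp)
  obtain ⟨G, hG, hGv⟩ := exists_adder (HasCost.wire (Sum.inl : Fin L → Fin L ⊕ Unit)) h1
    (HasCost.const_unit false)
  refine ⟨_, ((hG.select Sum.inl).comp hF).mono (by omega), fun x y hx hy => ?_⟩
  have h2 := hFv (Sum.elim x y)
  have h3 := hGv (F (Sum.elim x y))
  simp only [Sum.elim_inl, Sum.elim_inr, Bool.toNat_false] at h2 h3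
  change _ + bitVal y = bitVal x + _ at h2
  set R := bitVal fun j => G (F (Sum.elim x y)) (Sum.inl j) with hR
  have hRlt : R < 2 ^ L := bitVal_lt _
  have hT : (bitVal fun k => F (Sum.elim x y) (Sum.inl k)) < 2 ^ L := bitVal_lt _
  have hc' : (G (F (Sum.elim x y)) (Sum.inr ())).toNat ≤ 1 := Bool.toNat_le _
  set c' := (G (F (Sum.elim x y)) (Sum.inr ())).toNat
  cases hc : F (Sum.elim x y) (Sum.inr ())
  · have hm' : (bitVal fun k => !F (Sum.elim x y) (Sum.inr ()) && m k) = P % 2 ^ L := by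
      simpa [hc] using hm
    rw [hm'] at h3
    simp only [hc, Bool.toNat_false] at h2
    have h4 : R + bitVal y = bitVal x + P := by
      rcases hP.lt_or_eq with h | h
      · rw [Nat.mod_eq_of_lt h] at h3
        interval_cases c' <;> omega
      · rw [h, Nat.mod_self] at h3
        interval_cases c' <;> omega
    exact ⟨by omega, by rw [h4]; simp [Nat.ModEq]⟩
  · have hm' : (bitVal fun k => !F (Sum.elim x y) (Sum.inr ()) && m k) = 0 := by
      simp [hc, bitVal]
    rw [hm'] at h3
    simp only [hc, Bool.toNat_true] at h2
    have h4 : R + bitVal y = bitVal x := by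
      interval_cases c' <;> omega
    exact ⟨by omega, by rw [h4]⟩

/-- Long division by a constant. -/
theorem exists_divider {D W : ℕ} (hD : 0 < D) (hDW : D ≤ 2 ^ W) (L : ℕ) :
    ∃ F : (Fin L → Bool) → Fin L ⊕ Fin W → Bool, HasCost F (L * (10 * W + 10)) ∧
      ∀ x, D * (bitVal fun k => F x (Sum.inl k)) + (bitVal fun k => F x (Sum.inr k)) = bitVal x ∧
        (bitVal fun k => F x (Sum.inr k)) < D := by
  induction L with
  | zero =>
    refine ⟨fun _ => Sum.elim (fun k => k.elim0) fun _ => false, ?_, fun x => ?_⟩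
    · simpa using HasCost.const (Sum.elim (fun k : Fin 0 => k.elim0) fun _ : Fin W => false)
    · simp [bitVal, hD]
  | succ L ih =>
    obtain ⟨F, hF, hFv⟩ := ih
    obtain ⟨m, hm⟩ := exists_bitVal_eq (L := W + 1) (a := D)
      (hDW.trans_lt (Nat.pow_lt_pow_right (by norm_num) (by omega)))
    -- the inputs, followed by the quotient and the remainder of the upper part
    have h1 := hF.onInputs (Fin.succ : Fin L → Fin (L + 1))
    let ι := Fin (L + 1) ⊕ (Fin L ⊕ Fin W)
    -- twice the remainder plus the new digit
    have h2 := HasCost.wire (α := ι) (Fin.cons (α := fun _ => ι) (Sum.inl 0)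
      (fun k => Sum.inr (Sum.inr k)) : Fin (W + 1) → ι)
    obtain ⟨G, hG, hGv⟩ := exists_subtractor h2 (HasCost.const m)
    -- The difference is kept if there was no borrow, and the old value otherwise. This takes three
    -- gates per bit, after seven for the subtraction, hence `10 * (W + 1)` for each quotient digit.
    have h3 : HasCost (fun (x : ι ⊕ (Fin (W + 1) ⊕ Unit) → Bool) (k : Fin (W + 1)) =>
        x (Sum.inr (Sum.inr ())) && x (Sum.inr (Sum.inl k)) ||
          (!x (Sum.inr (Sum.inr ())) && x (Sum.inl ((Fin.cons (α := fun _ => ι) (Sum.inl 0)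
      (fun k => Sum.inr (Sum.inr k)) : Fin (W + 1) → ι) k)))) (3 * (W + 1)) := by
      refine (HasCost.bits_const (s := 3) fun k => ?_).mono (by simp [mul_comm])
      exact ((HasCost.bit _).op and (HasCost.bit _)).op or
        ((HasCost.bit _).op (fun c e => !c && e) (HasCost.bit _))
    have h4 := (((HasCost.wire (α := ι ⊕ (Fin (W + 1) ⊕ Unit)) (Fin.cons
      (α := fun _ => ι ⊕ (Fin (W + 1) ⊕ Unit)) (Sum.inr (Sum.inr ()))
      (fun k => Sum.inl (Sum.inr (Sum.inl k))) : Fin (L + 1) → ι ⊕ (Fin (W + 1) ⊕ Unit))).pair h3).select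
        (Sum.map id Fin.castSucc : Fin (L + 1) ⊕ Fin W → _))
    refine ⟨_, (h1.share (hG.share h4)).mono (by ring_nf; omega), fun x => ?_⟩
    obtain ⟨h5, h6⟩ := hFv fun k => x k.succ
    have h7 := hGv (Sum.elim x (F fun k => x k.succ))
    rw [bitVal_succ (fun k => Sum.elim x (F fun k => x k.succ) _), hm] at h7
    rw [bitVal_succ x, bitVal_succ]
    simp only [Fin.cons_zero, Fin.cons_succ, Sum.elim_inl, Sum.elim_inr, Sum.map_inl, Sum.map_inr,
      id] at h7 ⊢
    set g := G (Sum.elim x (F fun k => x k.succ)) with hg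
    set q := bitVal fun k => F (fun k => x k.succ) (Sum.inl k)
    set r := bitVal fun k => F (fun k => x k.succ) (Sum.inr k)
    have h8 := (x 0).toNat_le
    have hlt := bitVal_lt fun k => g (Sum.inl k)
    -- A remainder is below `D ≤ 2^W`, so its top bit is zero and may be dropped.
    have hlow : ∀ y : Fin (W + 1) → Bool, bitVal y < D → (bitVal fun k => y k.castSucc) = bitVal y := by
      intro y hy
      rw [bitVal_castSucc y] at hy ⊢
      cases hl : y (Fin.last W)
      · simp
      · rw [hl, Bool.toNat_true, mul_one] at hy
        omega
    rw [pow_succ] at h7 hlt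
    cases hc : g (Sum.inr ())
    · simp only [hc, Bool.toNat_false, Bool.false_and, Bool.false_or, Bool.not_false,
        Bool.true_and] at h7 ⊢
      let y : Fin (W + 1) → Bool := fun k => Sum.elim x (F fun i => x i.succ)
        ((Fin.cons (α := fun _ => ι) (Sum.inl 0) (fun k => Sum.inr (Sum.inr k)) :
          Fin (W + 1) → ι) k)
      have h9 : bitVal y = (x 0).toNat + 2 * r := by
        rw [bitVal_succ]
        rfl
      change D * (0 + 2 * q) + (bitVal fun k => y k.castSucc) = _ ∧
        (bitVal fun k => y k.castSucc) < D
      rw [hlow y (by rw [h9]; omega), h9]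
      refine ⟨?_, by omega⟩
      rw [← h5]
      ring
    · simp only [hc, Bool.toNat_true, Bool.true_and, Bool.not_true, Bool.false_and,
        Bool.or_false] at h7 ⊢
      rw [hlow (fun k => g (Sum.inl k)) (by omega)]
      refine ⟨?_, by omega⟩
      rw [← h5, mul_add, mul_one, mul_left_comm]
      omega

/-! ### Encodings -/

section Encodings

variable {p : ℕ} [Fact p.Prime] {O : Type*} [CommRing O] [Algebra ℤ_[p] O] {d lam : ℕ}
  (b : Module.Basis (Fin d) ℤ_[p] O)

/-- Index set of the bits that represent an element of `O / p ^ lam`. -/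
abbrev ElemBits (p lam d : ℕ) : Type := Fin d × Fin (Nat.size (p ^ lam - 1))

/-- The bits `x` represent the element `a`. -/
def EncodesElem {O : Type*} [CommRing O] {p lam d : ℕ} (b : Fin d → O)
    (x : ElemBits p lam d → Bool) (a : ModPow O p lam) : Prop :=
  (∀ j, (bitVal fun k => x (j, k)) < p ^ lam) ∧ a = ofCoords p lam b fun j => bitVal fun k => x (j, k)

theorem encodes_iff (b : Fin d → O) {n : ℕ} {x : PolyBits p lam d n → Bool}
    {f : Polynomial (ModPow O p lam)} :
    Encodes b x f ↔ (∀ i : Fin n, EncodesElem b (fun q => x (i, q)) (f.coeff i)) ∧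
      ∀ i, n ≤ i → f.coeff i = 0 := by
  have hc : ∀ i, (∑ i : Fin n, Polynomial.monomial (i : ℕ) (ofCoords p lam b (coordOf x i))).coeff i
      = if h : i < n then ofCoords p lam b (coordOf x ⟨i, h⟩) else 0 := by
    intro i
    rw [Polynomial.finsetSum_coeff]
    simp only [Polynomial.coeff_monomial]
    split_ifs with h
    · rw [Finset.sum_eq_single ⟨i, h⟩]
      · simp
      · intro j _ hj
        rw [if_neg fun h' => hj (Fin.ext h')]
      · simp
    · exact Finset.sum_eq_zero fun j _ => if_neg fun h' : (j : ℕ) = i => h (h' ▸ j.2)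
  constructor
  · rintro ⟨h1, rfl⟩
    refine ⟨fun i => ⟨h1 i, ?_⟩, fun i hi => ?_⟩
    · rw [hc, dif_pos i.2]
      rfl
    · rw [hc, dif_neg hi.not_gt]
  · rintro ⟨h1, h2⟩
    refine ⟨fun i => (h1 i).1, ?_⟩
    ext i
    rw [hc]
    split_ifs with h
    · exact (h1 ⟨i, h⟩).2
    · exact h2 i (not_lt.1 h)

theorem pow_le_two_pow_size : p ^ lam ≤ 2 ^ Nat.size (p ^ lam - 1) := by
  have := Nat.lt_size_self (p ^ lam - 1)
  omega

variable {b}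

theorem EncodesElem.unique {x y : ElemBits p lam d → Bool} {a : ModPow O p lam}
    (hx : EncodesElem b x a) (hy : EncodesElem b y a) : x = y := by
  have h := (ofCoords_eq_iff b _ _).1 (hx.2.symm.trans hy.2)
  ext ⟨j, k⟩
  have h1 := h j
  rw [Nat.ModEq, Nat.mod_eq_of_lt (hx.1 j), Nat.mod_eq_of_lt (hy.1 j)] at h1
  exact congrFun (bitVal_injective h1) k

theorem Encodes.unique {n : ℕ} {x y : PolyBits p lam d n → Bool} {f : Polynomial (ModPow O p lam)}
    (hx : Encodes b x f) (hy : Encodes b y f) : x = y := by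
  ext ⟨i, q⟩
  exact congrFun ((((encodes_iff _).1 hx).1 i).unique (((encodes_iff _).1 hy).1 i)) q

variable (b) in
theorem encodesElem_ofCoords {x : ElemBits p lam d → Bool} {a : Fin d → ℕ}
    (ha : ∀ j, a j < p ^ lam) (h : ∀ j, (bitVal fun k => x (j, k)) = a j) :
    EncodesElem b x (ofCoords p lam b a) :=
  ⟨fun j => (h j).trans_lt (ha j), by simp only [h]⟩

variable (b) in
theorem exists_encodesElem_ofCoords {a : Fin d → ℕ} (ha : ∀ j, a j < p ^ lam) :
    ∃ x : ElemBits p lam d → Bool, (∀ j, (bitVal fun k => x (j, k)) = a j) ∧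
      EncodesElem b x (ofCoords p lam b a) := by
  choose x hx using fun j => exists_bitVal_eq ((ha j).trans_le (pow_le_two_pow_size (p := p)))
  exact ⟨fun q => x q.1 q.2, hx, encodesElem_ofCoords b ha hx⟩

variable (b) in
theorem exists_encodesElem (a : ModPow O p lam) : ∃ x, EncodesElem b x a := by
  obtain ⟨a, ha, rfl⟩ := exists_ofCoords_eq b a
  obtain ⟨x, -, hx⟩ := exists_encodesElem_ofCoords b ha
  exact ⟨x, hx⟩

variable (b) in
theorem encodesElem_zero : EncodesElem b (fun _ : ElemBits p lam d => false) 0 := by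
  have hp : 0 < p ^ lam := pow_pos (Fact.out : p.Prime).pos _
  refine ⟨fun j => ?_, ?_⟩ <;> simp [bitVal_false, ofCoords, hp]

/-- Truncation, or padding with zeros. -/
def resizeBits {n : ℕ} (m : ℕ) (x : PolyBits p lam d n → Bool) : PolyBits p lam d m → Bool :=
  fun q => if h : (q.1 : ℕ) < n then x (⟨q.1, h⟩, q.2) else false

theorem HasCost.resize {α : Type} {n s : ℕ} {F : (α → Bool) → PolyBits p lam d n → Bool}
    (hF : HasCost F s) (m : ℕ) : HasCost (fun x => resizeBits m (F x)) s := by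
  have h : HasCost (resizeBits m : (PolyBits p lam d n → Bool) → PolyBits p lam d m → Bool) 0 := by
    refine HasCost.bits_zero fun q => ?_
    unfold resizeBits
    split_ifs with h
    · exact HasCost.bit _
    · exact HasCost.const_unit false
  exact (h.comp hF).mono (by simp)

theorem Encodes.resize {n : ℕ} {x : PolyBits p lam d n → Bool}
    {f : Polynomial (ModPow O p lam)} (h : Encodes b x f) (m : ℕ) :
    Encodes b (resizeBits m x) (trunc m (f : (ModPow O p lam)⟦X⟧)) := by
  rw [encodes_iff] at h ⊢
  refine ⟨fun i => ?_, fun i hi => ?_⟩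
  · rw [coeff_trunc, if_pos i.2, Polynomial.coeff_coe]
    by_cases hi : (i : ℕ) < n
    · have := h.1 ⟨i, hi⟩
      simpa [resizeBits, hi] using this
    · rw [h.2 _ (not_lt.1 hi)]
      simpa [resizeBits, hi] using encodesElem_zero b
  · rw [coeff_trunc, if_neg (by omega)]

theorem Encodes.trunc_eq {n m : ℕ} {x : PolyBits p lam d n → Bool}
    {f : Polynomial (ModPow O p lam)} (h : Encodes b x f) (hnm : n ≤ m) :
    trunc m (f : (ModPow O p lam)⟦X⟧) = f := by
  ext i
  rw [coeff_trunc, Polynomial.coeff_coe]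
  split_ifs with hi
  · rfl
  · exact (((encodes_iff _).1 h).2 i (by omega)).symm

theorem Encodes.resize_of_le {n m : ℕ} {x : PolyBits p lam d n → Bool}
    {f : Polynomial (ModPow O p lam)} (h : Encodes b x f) (hnm : n ≤ m) :
    Encodes b (resizeBits m x) f := by
  have := h.resize m
  rwa [h.trunc_eq hnm] at this

variable (b) in
theorem exists_encodes {n : ℕ} {f : Polynomial (ModPow O p lam)} (h : ∀ i, n ≤ i → f.coeff i = 0) :
    ∃ x : PolyBits p lam d n → Bool, Encodes b x f := by
  choose x hx using fun i => exists_encodesElem b (f.coeff i)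
  exact ⟨fun q => x q.1 q.2, (encodes_iff _).2 ⟨fun i => hx i, h⟩⟩

theorem Encodes.elem {n : ℕ} {x : PolyBits p lam d n → Bool}
    {f : Polynomial (ModPow O p lam)} (h : Encodes b x f) (i : Fin n) :
    EncodesElem b (fun q => x (i, q)) (f.coeff i) := ((encodes_iff _).1 h).1 i

/-! ### The size of multiplication circuits -/

/-- Multiplying by `1` makes every bit of the first factor matter; multiplying by `0` shows that no
output merely copies such a bit, because the code of zero is unique. So each bit enters a gate, and
a gate has two inputs. -/
theorem ComputesMul.le_size {n : ℕ}
    {c : BoolCircuit (PolyBits p lam d (n + 1) ⊕ PolyBits p lam d (n + 1))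
      (PolyBits p lam d (2 * n + 1))} (hc : ComputesMul b n c) :
    (n + 1) * (d * Nat.size (p ^ lam - 1)) ≤ 2 * c.size := by
  classical
  obtain ⟨T, hT, hTj⟩ := c.exists_gate_inputs
  obtain ⟨y₁, hy₁⟩ := exists_encodes b (n := n + 1) (f := (1 : Polynomial (ModPow O p lam)))
    fun i hi => by rw [Polynomial.coeff_one, if_neg (by omega)]
  obtain ⟨y₀, hy₀⟩ := exists_encodes b (n := n + 1) (f := (0 : Polynomial (ModPow O p lam)))
    fun i hi => by simp
  have hx₀ : Encodes b (fun _ : PolyBits p lam d (n + 1) => false)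
      (0 : Polynomial (ModPow O p lam)) :=
    (encodes_iff _).2 ⟨fun i => by simpa using encodesElem_zero b, fun i _ => by simp⟩
  have hmem : ∀ a : PolyBits p lam d (n + 1), Sum.inl a ∈ T := by
    intro a
    by_contra ha
    set x : PolyBits p lam d (n + 1) → Bool := fun a' => decide (a' = a) with hx
    obtain ⟨f, hf⟩ : ∃ f, Encodes b x f := by
      refine ⟨_, fun i j => ?_, rfl⟩
      -- A single bit is a valid code because the length is that of `p^lam - 1`.
      have hlt : 2 ^ (a.2.2 : ℕ) < p ^ lam := by
        have h1 : 2 ^ (a.2.2 : ℕ) ≤ p ^ lam - 1 := Nat.lt_size.1 a.2.2.2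
        have h2 : 0 < 2 ^ (a.2.2 : ℕ) := by positivity
        omega
      refine lt_of_le_of_lt ?_ hlt
      unfold coordOf
      refine (Finset.sum_le_sum (g := fun k => if k = a.2.2 then 2 ^ (a.2.2 : ℕ) else 0)
        fun k _ => ?_).trans (by simp)
      by_cases hk : k = a.2.2
      · simp only [hk, if_true]
        split_ifs <;> simp
      · have : (i, j, k) ≠ a := fun h => hk (by rw [← h])
        simp [hx, this, hk]
    have h1 := hc x y₁ f 1 hf hy₁
    have h2 := hc _ y₁ 0 1 hx₀ hy₁
    have h3 := hc x y₀ f 0 hf hy₀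
    have h4 := hc _ y₀ 0 0 hx₀ hy₀
    have hne : c.eval (Sum.elim x y₁) ≠ c.eval (Sum.elim (fun _ => false) y₁) := by
      intro h
      rw [h] at h1
      rw [mul_one] at h1 h2
      have hf0 : f = 0 := by
        ext i
        by_cases hi : i < 2 * n + 1
        · rw [(h1.elem ⟨i, hi⟩).2, (h2.elem ⟨i, hi⟩).2]
        · rw [((encodes_iff _).1 h1).2 i (by omega), Polynomial.coeff_zero]
      rw [hf0] at hf
      have := congrFun (hf.unique hx₀) a
      simp [hx] at this
    obtain ⟨j, hj⟩ := Function.ne_iff.1 hne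
    rcases hTj j with ⟨a', ha'⟩ | h
    · rw [ha', ha'] at hj
      rcases a' with a' | a'
      · have : a' = a := by
          by_contra hne
          simp [hx, hne] at hj
        subst this
        rw [mul_zero] at h3 h4
        have := congrFun (h3.unique h4) j
        rw [ha', ha'] at this
        simp [hx] at this
      · simp at hj
    · refine hj (h _ _ fun a' ha' => ?_)
      rcases a' with a' | a'
      · have : a' ≠ a := by
          rintro rfl
          exact ha ha'
        simp [hx, this]
      · rfl
  have hcard := Finset.card_le_card (s := Finset.univ.map Function.Embedding.inl)
    (t := T) fun a' ha' => by
      obtain ⟨a, -, rfl⟩ := Finset.mem_map.1 ha'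
      exact hmem a
  rw [Finset.card_map, Finset.card_univ] at hcard
  simp only [Fintype.card_prod, Fintype.card_fin] at hcard
  exact hcard.trans hT

end Encodings

/-! ### Circuits for polynomial arithmetic -/

section Arithmetic

variable {p : ℕ} [Fact p.Prime] {O : Type*} [CommRing O] [Algebra ℤ_[p] O] {d lam : ℕ}
  {b : Module.Basis (Fin d) ℤ_[p] O} {α : Type}

variable (b) in
theorem exists_hasCost_sub {n s t : ℕ} {A B : (α → Bool) → PolyBits p lam d n → Bool}
    (hA : HasCost A s) (hB : HasCost B t) :
    ∃ F : (α → Bool) → PolyBits p lam d n → Bool,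
      HasCost F (s + t + 14 * (n * (d * Nat.size (p ^ lam - 1)))) ∧
      ∀ x f g, Encodes b (A x) f → Encodes b (B x) g → Encodes b (F x) (f - g) := by
  obtain ⟨G, hG, hGv⟩ := exists_modSub (pow_le_two_pow_size (p := p) (lam := lam))
  have h1 := HasCost.family fun ij : Fin n × Fin d => hG.onInputs
    (Sum.map (fun k => (ij.1, ij.2, k)) (fun k => (ij.1, ij.2, k)) :
      _ → PolyBits p lam d n ⊕ PolyBits p lam d n)
  refine ⟨_, (((h1.select fun q : PolyBits p lam d n => ((q.1, q.2.1), q.2.2)).comp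
    (hA.pair hB))).mono ?_, fun x f g hf hg => ?_⟩
  · simp only [Finset.sum_const, Finset.card_univ, Fintype.card_prod, Fintype.card_fin,
      smul_eq_mul]
    ring_nf
    rfl
  · have hsplit : ∀ i : Fin n, ∀ j : Fin d,
        (fun k => (Sum.elim (A x) (B x)) (Sum.map (fun k => ((i, j, k) : PolyBits p lam d n))
          (fun k => ((i, j, k) : PolyBits p lam d n)) k)) =
        Sum.elim (fun k => A x (i, j, k)) (fun k => B x (i, j, k)) := by
      intro i j
      ext (k | k) <;> rfl
    rw [encodes_iff]
    refine ⟨fun i => ?_, fun i hi => ?_⟩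
    · have hfi := hf.elem i
      have hgi := hg.elem i
      have hv := fun j => hGv _ _ (hfi.1 j) (hgi.1 j)
      refine ⟨fun j => ?_, ?_⟩
      · simp only [hsplit]
        exact (hv j).1
      · simp only [hsplit]
        rw [Polynomial.coeff_sub, sub_eq_iff_eq_add, hfi.2, hgi.2]
        have := (ofCoords_eq_iff b (lam := lam) _ _).2 fun j => (hv j).2
        rw [← this]
        simp only [ofCoords, Nat.cast_add, add_mul, Finset.sum_add_distrib]
    · rw [Polynomial.coeff_sub, ((encodes_iff _).1 hf).2 i hi, ((encodes_iff _).1 hg).2 i hi,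
        sub_zero]

theorem exists_hasCost_mul {k m s t : ℕ}
    (hm : ∃ c, ComputesMul (p := p) (lam := lam) b k c ∧ c.size ≤ m)
    {A B : (α → Bool) → PolyBits p lam d (k + 1) → Bool} (hA : HasCost A s) (hB : HasCost B t) :
    ∃ F : (α → Bool) → PolyBits p lam d (2 * k + 1) → Bool, HasCost F (s + t + m) ∧
      ∀ x f g, Encodes b (A x) f → Encodes b (B x) g → Encodes b (F x) (f * g) := by
  obtain ⟨c, hc, hcm⟩ := hm
  exact ⟨_, ((HasCost.of_circuit c).comp (hA.pair hB)).mono (by omega),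
    fun x f g hf hg => hc _ _ _ _ hf hg⟩

theorem exists_hasCost_mul_const {m : ℕ}
    (hm : ∃ c, ComputesMul (p := p) (lam := lam) b 0 c ∧ c.size ≤ m) (r : ModPow O p lam) :
    ∃ F : (ElemBits p lam d → Bool) → ElemBits p lam d → Bool, HasCost F m ∧
      ∀ x a, EncodesElem b x a → EncodesElem b (F x) (r * a) := by
  obtain ⟨y, hy⟩ := exists_encodes b (n := 1) (f := Polynomial.C r) fun i hi => by
    rw [Polynomial.coeff_C, if_neg (by omega)]
  obtain ⟨F, hF, hFv⟩ := exists_hasCost_mul hm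
    (HasCost.wire (fun q : PolyBits p lam d 1 => q.2)) (HasCost.const y)
  refine ⟨_, (hF.select fun q => ((0 : Fin 1), q)).mono (by omega), fun x a hx => ?_⟩
  have h1 : Encodes b (fun q : PolyBits p lam d 1 => x q.2) (Polynomial.C a) := by
    rw [encodes_iff]
    refine ⟨fun i => ?_, fun i hi => ?_⟩
    · rw [Polynomial.coeff_C, if_pos (by omega)]
      exact hx
    · rw [Polynomial.coeff_C, if_neg (by omega)]
  have h2 := (hFv x _ _ h1 hy).elem (0 : Fin 1)
  rw [← Polynomial.C_mul] at h2
  simpa [mul_comm] using h2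

theorem exists_hasCost_derivative {n m s : ℕ}
    (hm : ∃ c, ComputesMul (p := p) (lam := lam) b 0 c ∧ c.size ≤ m)
    {A : (α → Bool) → PolyBits p lam d (n + 1) → Bool} (hA : HasCost A s) :
    ∃ F : (α → Bool) → PolyBits p lam d n → Bool, HasCost F (s + n * m) ∧
      ∀ x f, Encodes b (A x) f → Encodes b (F x) (Polynomial.derivative f) := by
  choose F hF hFv using fun i : Fin n => exists_hasCost_mul_const hm ((i : ℕ) + 1 : ModPow O p lam)
  have h1 := HasCost.family fun i : Fin n => (hF i).onInputs
    (fun q => ((i.succ, q) : PolyBits p lam d (n + 1)))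
  refine ⟨_, (h1.comp hA).mono (by simp), fun x f hf => ?_⟩
  rw [encodes_iff]
  refine ⟨fun i => ?_, fun i hi => ?_⟩
  · rw [Polynomial.coeff_derivative, mul_comm]
    exact hFv i _ _ (hf.elem i.succ)
  · rw [Polynomial.coeff_derivative, ((encodes_iff _).1 hf).2 (i + 1) (by omega), zero_mul]

/-- The bits `x`, the last of which is an error flag, represent the result of a computation in
`O / p ^ lam` that may raise an error. -/
def EncodesElemResult {O : Type*} [CommRing O] {p lam d : ℕ} (b : Fin d → O)
    (x : ElemBits p lam d ⊕ Unit → Bool) : Option (ModPow O p lam) → Prop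
  | none => x (Sum.inr ()) = true
  | some a => x (Sum.inr ()) = false ∧ EncodesElem b (fun i => x (Sum.inl i)) a

/-- A product with the inverse of the prime-to-`p` part leaves a long division of the coordinates by
`p^v`, whose cost grows with `v`. The error flag is the disjunction of the remainder bits. -/
theorem exists_hasCost_fixedDiv {m : ℕ}
    (hm : ∃ c, ComputesMul (p := p) (lam := lam) b 0 c ∧ c.size ≤ m) {i : ℕ} (hi : i ≠ 0)
    (hv : padicValNat p i ≤ lam) :
    ∃ F : (ElemBits p lam d → Bool) → ElemBits p lam d ⊕ Unit → Bool,
      HasCost F (m + d * (Nat.size (p ^ lam - 1) * (10 * (padicValNat p i * Nat.size p) + 10))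
        + d * (padicValNat p i * Nat.size p)) ∧
      ∀ x a, EncodesElem b x a → EncodesElemResult b (F x) (fixedDiv p lam b a i) := by
  obtain ⟨m', s, hm', hs⟩ := exists_eq_pow_padicValNat_mul p lam hi
  set v := padicValNat p i
  set L := Nat.size (p ^ lam - 1)
  have hpv : 0 < p ^ v := pow_pos (Fact.out : p.Prime).pos _
  have hW : p ^ v ≤ 2 ^ (v * Nat.size p) := by
    rw [mul_comm, pow_mul]
    exact Nat.pow_le_pow_left (Nat.lt_size_self p).le _
  obtain ⟨F, hF, hFv⟩ := exists_hasCost_mul_const hm (s : ModPow O p lam)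
  obtain ⟨G, hG, hGv⟩ := exists_divider hpv hW L
  have h1 := HasCost.family fun j : Fin d => hG.onInputs (fun k => ((j, k) : ElemBits p lam d))
  obtain ⟨flag, h2, hflag'⟩ := HasCost.exists_bit fun q : Fin d × Fin (v * Nat.size p) =>
    HasCost.bit (α := Fin d × (Fin L ⊕ Fin (v * Nat.size p))) (q.1, Sum.inr q.2)
  have h3 := (HasCost.wire (fun q : ElemBits p lam d =>
    ((q.1, Sum.inl q.2) : Fin d × (Fin L ⊕ Fin (v * Nat.size p))))).pair h2
  refine ⟨_, ((h3.comp h1).comp hF).mono ?_, fun x a hx => ?_⟩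
  · simp only [Finset.sum_const, Finset.card_univ, Fintype.card_prod, Fintype.card_fin,
      smul_eq_mul]
    omega
  · have hy := hFv x a hx
    set y := F x
    have hdiv := fun j => hGv fun k => y (j, k)
    have hrem : ∀ j, (bitVal fun k => G (fun k => y (j, k)) (Sum.inr k)) =
        (bitVal fun k => y (j, k)) % p ^ v := by
      intro j
      rw [← (hdiv j).1, Nat.mul_add_mod, Nat.mod_eq_of_lt (hdiv j).2]
    have hquo : ∀ j, (bitVal fun k => G (fun k => y (j, k)) (Sum.inl k)) =
        (bitVal fun k => y (j, k)) / p ^ v := by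
      intro j
      rw [← (hdiv j).1, Nat.mul_add_div hpv, Nat.div_eq_of_lt (hdiv j).2, add_zero]
    have hflag : (∃ q : Fin d × Fin (v * Nat.size p),
        G (fun k => y (q.1, k)) (Sum.inr q.2) = true) ↔
        ¬ ∀ j, p ^ v ∣ bitVal fun k => y (j, k) := by
      constructor
      · rintro ⟨⟨j, k⟩, hk⟩ hd
        have h4 := hrem j
        rw [Nat.mod_eq_zero_of_dvd (hd j), ← bitVal_false (L := v * Nat.size p)] at h4
        have := congrFun (bitVal_injective h4) k
        simp_all
      · intro hd
        by_contra hq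
        refine hd fun j => Nat.dvd_of_mod_eq_zero ?_
        rw [← hrem, ← bitVal_false (L := v * Nat.size p)]
        congr 1
        ext k
        by_contra hk
        exact hq ⟨(j, k), by simpa using hk⟩
    rw [hm', fixedDiv_eq b hv hs hy.1 hy.2]
    split_ifs with hd
    · refine ⟨?_, encodesElem_ofCoords b (fun j => ?_) hquo⟩
      · exact Bool.eq_false_iff.2 fun h => hflag.1 ((hflag' _).1 h) hd
      · exact (Nat.div_le_self _ _).trans_lt (hy.1 j)
    · exact (hflag' _).2 (hflag.2 hd)

/-- The valuations add up to `v_p(n!)`, Legendre's formula gives `(p - 1) v_p(n!) ≤ n`, and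
`Nat.size p ≤ p ≤ 2 (p - 1)`. Hence schoolbook division is cheap on average over `i ≤ n`. -/
theorem sum_padicValNat_mul_size_le (n : ℕ) :
    ∑ i : Fin n, padicValNat p ((i : ℕ) + 1) * Nat.size p ≤ 2 * n := by
  have h1 : ∑ i : Fin n, padicValNat p ((i : ℕ) + 1) = padicValNat p n.factorial := by
    rw [Fin.sum_univ_eq_sum_range fun i => padicValNat p (i + 1)]
    induction n with
    | zero => simp
    | succ n ih =>
      rw [Finset.sum_range_succ, ih, Nat.factorial_succ,
        padicValNat.mul n.succ_ne_zero n.factorial_ne_zero, add_comm]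
  have h2 := sub_one_mul_padicValNat_factorial (p := p) n
  have hp := (Fact.out : p.Prime).two_le
  have h3 : Nat.size p ≤ 2 * (p - 1) := by
    have : Nat.size p ≤ p := Nat.size_le.2 Nat.lt_two_pow_self
    omega
  rw [← Finset.sum_mul, h1]
  calc padicValNat p n.factorial * Nat.size p ≤ padicValNat p n.factorial * (2 * (p - 1)) :=
        Nat.mul_le_mul_left _ h3
    _ = 2 * ((p - 1) * padicValNat p n.factorial) := by ring
    _ ≤ 2 * n := by rw [h2]; omega

theorem card_coords_pos [Nontrivial O] (b : Module.Basis (Fin d) ℤ_[p] O) : 0 < d :=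
  Fin.pos_iff_nonempty.2 b.index_nonempty

theorem size_pos (hlam : 0 < lam) : 0 < Nat.size (p ^ lam - 1) := by
  have := Nat.one_lt_pow hlam.ne' (Fact.out : p.Prime).one_lt
  exact Nat.size_pos.2 (by omega)

theorem exists_hasCost_fixedPrimitive [Nontrivial O] {n m s : ℕ} (hlam : 0 < lam)
    (hm : ∃ c, ComputesMul (p := p) (lam := lam) b 0 c ∧ c.size ≤ m)
    (hv : ∀ i, i ≠ 0 → i ≤ n → padicValNat p i ≤ lam)
    {A : (α → Bool) → PolyBits p lam d n → Bool} (hA : HasCost A s) :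
    ∃ F : (α → Bool) → PolyBits p lam d (n + 1) ⊕ Unit → Bool,
      HasCost F (s + n * m + 33 * (n * (d * Nat.size (p ^ lam - 1)))) ∧
      ∀ x f, Encodes b (A x) f →
        EncodesResult b (F x) (fixedPrimitive p lam b n (f : (ModPow O p lam)⟦X⟧)) := by
  choose F hF hFv using fun i : Fin n =>
    exists_hasCost_fixedDiv hm i.1.succ_ne_zero (hv _ i.1.succ_ne_zero i.2)
  set L := Nat.size (p ^ lam - 1)
  have h1 := HasCost.family fun i : Fin n => (hF i).onInputs
    (fun q => ((i, q) : PolyBits p lam d n))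
  obtain ⟨flag, h2, hflag⟩ := HasCost.exists_bit fun i : Fin n =>
    HasCost.bit (α := Fin n × (ElemBits p lam d ⊕ Unit)) (i, Sum.inr ())
  have h3 : HasCost (fun (x : Fin n × (ElemBits p lam d ⊕ Unit) → Bool)
      (q : PolyBits p lam d (n + 1)) =>
        Fin.cases (motive := fun _ => Bool) false (fun i => x (i, Sum.inl q.2)) q.1) 0 := by
    refine HasCost.bits_zero fun ⟨i, q⟩ => ?_
    refine Fin.cases ?_ (fun i => ?_) i
    · exact HasCost.const_unit false
    · exact HasCost.bit _
  refine ⟨_, (((h3.pair h2).comp h1).comp hA).mono ?_, fun x f hf => ?_⟩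
  · have hd := card_coords_pos b
    have hL : 0 < L := size_pos (p := p) hlam
    have hS := sum_padicValNat_mul_size_le (p := p) n
    change s + (∑ i : Fin n, (m + d * (L * (10 * (padicValNat p (i.1 + 1) * Nat.size p) + 10))
        + d * (padicValNat p (i.1 + 1) * Nat.size p)) + (0 + ∑ i : Fin n, (0 + 1))) ≤ _
    have h4 : ∑ i : Fin n, (m + d * (L * (10 * (padicValNat p (i.1 + 1) * Nat.size p) + 10))
        + d * (padicValNat p (i.1 + 1) * Nat.size p)) =
        n * m + 10 * (n * (d * L)) + (10 * (d * L) + d) *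
          ∑ i : Fin n, padicValNat p ((i : ℕ) + 1) * Nat.size p := by
      have h5 : n * m + 10 * (n * (d * L)) = ∑ _i : Fin n, (m + 10 * (d * L)) := by
        simp only [Finset.sum_const, Finset.card_univ, Fintype.card_fin, smul_eq_mul]
        ring
      rw [h5, Finset.mul_sum, ← Finset.sum_add_distrib]
      exact Finset.sum_congr rfl fun _ _ => by ring
    rw [h4]
    -- This contributes `22` to the constant `33`; the remaining `11` are `10` for the part of the
    -- divisions independent of the valuation and `1` for merging the flags.
    have h5 : (10 * (d * L) + d) * ∑ i : Fin n, padicValNat p ((i : ℕ) + 1) * Nat.size p ≤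
        (11 * (d * L)) * (2 * n) := by
      refine Nat.mul_le_mul ?_ hS
      have := Nat.le_mul_of_pos_right d hL
      omega
    have h6 : n ≤ n * (d * L) := Nat.le_mul_of_pos_right n (Nat.mul_pos hd hL)
    have h7 : (11 * (d * L)) * (2 * n) = 22 * (n * (d * L)) := by ring
    simp only [Finset.sum_const, Finset.card_univ, Fintype.card_fin, smul_eq_mul]
    omega
  · have hres := fun i => hFv i _ _ (hf.elem i)
    cases hE : fixedPrimitive p lam b n (f : (ModPow O p lam)⟦X⟧) with
    | none =>
      obtain ⟨i, hi, h0⟩ := (fixedPrimitive_eq_none_iff b).1 hE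
      have h4 := hres ⟨i, hi⟩
      rw [Polynomial.coeff_coe] at h0
      rw [show fixedDiv p lam b (f.coeff i) i.succ = none from h0] at h4
      exact (hflag _).2 ⟨⟨i, hi⟩, h4⟩
    | some E =>
      obtain ⟨h4, h5, h6⟩ := (fixedPrimitive_eq_some_iff b).1 hE
      have h7 : ∀ i : Fin n, fixedDiv p lam b (f.coeff i) i.1.succ = some (E.coeff (i + 1)) :=
        fun i => by
          have := h4 i i.2
          rwa [Polynomial.coeff_coe] at this
      have h8 := fun i => hres i
      simp only [h7] at h8
      refine ⟨?_, (encodes_iff _).2 ⟨fun i => ?_, fun i hi => h6 i hi⟩⟩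
      · refine Bool.eq_false_iff.2 fun h => ?_
        obtain ⟨i, hi⟩ := (hflag _).1 h
        exact Bool.false_ne_true ((h8 i).1.symm.trans hi)
      · refine Fin.cases ?_ (fun i => ?_) i
        · simpa [h5] using encodesElem_zero b
        · exact (h8 i).2

end Arithmetic

/-! ### Newton inversion -/

section Inversion

variable {R : Type*} [CommRing R]

theorem trunc_eq_trunc_iff {f g : R⟦X⟧} {n : ℕ} : trunc n f = trunc n g ↔ X ^ n ∣ f - g := by
  rw [X_pow_dvd_iff]
  constructor
  · intro h i hi
    have := congrArg (fun q => Polynomial.coeff q i) h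
    simpa [coeff_trunc, hi, sub_eq_zero] using this
  · intro h
    ext i
    rw [coeff_trunc, coeff_trunc]
    split_ifs with hi
    · exact sub_eq_zero.1 (by simpa using h i hi)
    · rfl

theorem X_pow_dvd_invOfUnit_sub {f g : R⟦X⟧} {n : ℕ} (hf : constantCoeff f = 1)
    (hg : constantCoeff g = 1) (h : X ^ n ∣ f - g) : X ^ n ∣ invOfUnit f 1 - invOfUnit g 1 := by
  have h1 := mul_invOfUnit f 1 (by simpa using hf)
  have h2 := mul_invOfUnit g 1 (by simpa using hg)
  convert h.mul_left (-(invOfUnit f 1 * invOfUnit g 1)) using 1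
  linear_combination invOfUnit g 1 * h1 - invOfUnit f 1 * h2

/-- With `δ = w - 1/f`, the exact Newton update has error `-f δ^2`. The series `t` and `s` stand for
truncated products. -/
theorem X_pow_dvd_newton_inverse {f w t s : R⟦X⟧} {m n : ℕ} (hf : constantCoeff f = 1)
    (hn : n ≤ 2 * m) (hw : X ^ m ∣ w - invOfUnit f 1) (ht : X ^ n ∣ t - f * w)
    (hs : X ^ n ∣ s - w * (t - 1)) : X ^ n ∣ w - s - invOfUnit f 1 := by
  have h1 := mul_invOfUnit f 1 (by simpa using hf)
  have h2 : X ^ n ∣ (w - invOfUnit f 1) * (w - invOfUnit f 1) := by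
    refine (pow_dvd_pow _ hn).trans ?_
    rw [two_mul, pow_add]
    exact mul_dvd_mul hw hw
  have h3 := ((h2.mul_left (-f)).sub hs).sub (ht.mul_left w)
  convert h3 using 1
  linear_combination (invOfUnit f 1 - 2 * w) * h1

end Inversion

/-! ### What a Newton step depends on -/

section NewtonStep

variable {p : ℕ} {O : Type*} [CommRing O] {d : ℕ} (b : Fin d → O) {lam : ℕ}

theorem fixedPrimitive_congr {n : ℕ} {e e' : (ModPow O p lam)⟦X⟧} (h : X ^ n ∣ e - e') :
    fixedPrimitive p lam b n e = fixedPrimitive p lam b n e' := by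
  have h1 : ∀ i < n, coeff i e = coeff i e' := fun i hi =>
    sub_eq_zero.1 (by simpa using X_pow_dvd_iff.1 h i hi)
  ext E
  rw [fixedPrimitive_eq_some_iff, fixedPrimitive_eq_some_iff]
  refine and_congr_left fun _ => forall₂_congr fun i hi => ?_
  rw [h1 i hi]

theorem newtonStep_def {n : ℕ} {g h u : Polynomial (ModPow O p lam)} :
    newtonStep p lam b n g h u = (fixedPrimitive p lam b n
      (((Polynomial.derivative u : Polynomial (ModPow O p lam)) : (ModPow O p lam)⟦X⟧) *
        invOfUnit ((h.comp u : Polynomial (ModPow O p lam)) : (ModPow O p lam)⟦X⟧) 1 -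
        (g : (ModPow O p lam)⟦X⟧))).map fun E : Polynomial (ModPow O p lam) => trunc (n + 1) ((u : (ModPow O p lam)⟦X⟧) -
          ((h.comp u : Polynomial (ModPow O p lam)) : (ModPow O p lam)⟦X⟧) *
            (E : (ModPow O p lam)⟦X⟧)) := by
  unfold newtonStep
  dsimp only
  generalize fixedPrimitive p lam b n _ = o
  cases o <;> rfl

/-- Knowing `h(u)` modulo `t^n` is enough for a result modulo `t^(n+1)`, because it is multiplied by
a primitive without constant term. -/
theorem newtonStep_eq {n : ℕ} {g h u : Polynomial (ModPow O p lam)} {f e : (ModPow O p lam)⟦X⟧}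
    (hf : X ^ n ∣ f - ((h.comp u : Polynomial (ModPow O p lam)) : (ModPow O p lam)⟦X⟧))
    (he : X ^ n ∣ e - (((Polynomial.derivative u : Polynomial (ModPow O p lam)) :
      (ModPow O p lam)⟦X⟧) *
        invOfUnit ((h.comp u : Polynomial (ModPow O p lam)) : (ModPow O p lam)⟦X⟧) 1 -
        (g : (ModPow O p lam)⟦X⟧))) :
    newtonStep p lam b n g h u = (fixedPrimitive p lam b n e).map fun E : Polynomial (ModPow O p lam) =>
      trunc (n + 1) ((u : (ModPow O p lam)⟦X⟧) - f * (E : (ModPow O p lam)⟦X⟧)) := by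
  rw [newtonStep_def, ← fixedPrimitive_congr b he]
  refine Option.map_congr fun E hE => ?_
  rw [trunc_eq_trunc_iff]
  have hE0 := ((fixedPrimitive_eq_some_iff b).1 hE).2.1
  have h1 : (X : (ModPow O p lam)⟦X⟧) ∣ E := X_dvd_iff.2 (by simpa using hE0)
  have h2 := mul_dvd_mul hf h1
  rw [← pow_succ] at h2
  convert h2 using 1
  ring

theorem X_pow_dvd_comp_sub_comp {R : Type*} [CommRing R] {h h' u : Polynomial R} {n : ℕ}
    (hh : ∀ i < n, h.coeff i = h'.coeff i) (hu : u.coeff 0 = 0) :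
    X ^ n ∣ ((h.comp u : Polynomial R) : R⟦X⟧) - ((h'.comp u : Polynomial R) : R⟦X⟧) := by
  obtain ⟨q, hq⟩ : (Polynomial.X : Polynomial R) ^ n ∣ h - h' := by
    rw [Polynomial.X_pow_dvd_iff]
    intro i hi
    rw [Polynomial.coeff_sub, hh i hi, sub_self]
  have hX : (X : R⟦X⟧) ∣ u := X_dvd_iff.2 (by simpa using hu)
  rw [coe_comp_eq_aeval, coe_comp_eq_aeval, ← map_sub, hq, map_mul, map_pow, Polynomial.aeval_X]
  exact (pow_dvd_pow_of_dvd hX n).mul_right _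

theorem constantCoeff_comp {R : Type*} [CommRing R] {h u : Polynomial R} (hu : u.coeff 0 = 0) :
    constantCoeff ((h.comp u : Polynomial R) : R⟦X⟧) = h.coeff 0 := by
  rw [coe_comp_eq_aeval, constantCoeff_aeval (by simpa using hu)]

/-- The inner circuits see `g` and `h` truncated to their own order, while the algorithm passes them
on unchanged; the steps agree. -/
theorem newtonStep_congr {n : ℕ} {g g' h h' u : Polynomial (ModPow O p lam)} (hn : 0 < n)
    (hg : ∀ i < n, g.coeff i = g'.coeff i) (hh : ∀ i < n, h.coeff i = h'.coeff i)
    (hh0 : h.coeff 0 = 1) (hu : u.coeff 0 = 0) :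
    newtonStep p lam b n g h u = newtonStep p lam b n g' h' u := by
  have hc := X_pow_dvd_comp_sub_comp hh hu
  rw [newtonStep_eq b (g := g') hc, newtonStep_def]
  · have h1 := X_pow_dvd_invOfUnit_sub ((constantCoeff_comp hu).trans hh0)
      ((constantCoeff_comp hu).trans ((hh 0 hn).symm.trans hh0)) hc
    have h2 : X ^ n ∣ (g : (ModPow O p lam)⟦X⟧) - (g' : (ModPow O p lam)⟦X⟧) := by
      rw [X_pow_dvd_iff]
      intro i hi
      simp [hg i hi]
    convert (h1.mul_left ((Polynomial.derivative u : Polynomial (ModPow O p lam)) :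
      (ModPow O p lam)⟦X⟧)).sub h2 using 1
    ring

theorem coeff_zero_newtonStep {n : ℕ} {g h u v : Polynomial (ModPow O p lam)}
    (hv : newtonStep p lam b n g h u = some v) : v.coeff 0 = u.coeff 0 := by
  rw [newtonStep_def] at hv
  obtain ⟨E, hE, rfl⟩ := Option.map_eq_some_iff.1 hv
  have hE0 := ((fixedPrimitive_eq_some_iff b).1 hE).2.1
  rw [coeff_trunc, if_pos n.succ_pos]
  simp [hE0]

/-- Composition circuits are specified only for arguments without constant term. -/
theorem coeff_zero_DSol {g h v : Polynomial (ModPow O p lam)} {n : ℕ}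
    (hv : DSol p lam b g h n = some v) : v.coeff 0 = 0 := by
  induction n using Nat.strong_induction_on generalizing v with
  | _ n ih =>
    rcases n with _ | n
    · rw [DSol] at hv
      simp [← Option.some_injective _ hv]
    · rw [DSol] at hv
      obtain ⟨u, hu, huv⟩ := Option.bind_eq_some_iff.1 hv
      rw [coeff_zero_newtonStep b huv, ih _ (by omega) hu]

end NewtonStep

/-! ### A circuit for the inversion of power series -/

section StepCircuit

variable {p : ℕ} [Fact p.Prime] {O : Type*} [CommRing O] [Algebra ℤ_[p] O] {d lam : ℕ}
  {b : Module.Basis (Fin d) ℤ_[p] O} {M C : ℕ → ℕ}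

theorem exists_hasCost_invOfUnit (hM2 : ∀ k, 0 < k → 2 * M k ≤ M (2 * k)) (hMm : Monotone M)
    (hM : ∀ k, ∃ c, ComputesMul (p := p) (lam := lam) b k c ∧ c.size ≤ M k) (D : ℕ) :
    ∃ F : (PolyBits p lam d (D + 1) → Bool) → PolyBits p lam d (D + 1) → Bool,
      HasCost F (if D = 0 then 0 else 116 * M D) ∧ ∀ x f, Encodes b x f → f.coeff 0 = 1 →
        Encodes b (F x) (trunc (D + 1) (invOfUnit (f : (ModPow O p lam)⟦X⟧) 1)) := by
  have h1e : ∀ D : ℕ, ∃ y : PolyBits p lam d (D + 1) → Bool, Encodes b y 1 := fun D =>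
    exists_encodes b fun i hi => by rw [Polynomial.coeff_one, if_neg (by omega)]
  induction D using Nat.strong_induction_on with
  | _ D ih =>
    obtain ⟨y, hy⟩ := h1e D
    rcases Nat.eq_zero_or_pos D with rfl | hD
    · refine ⟨_, HasCost.const y, fun x f hf hf0 => ?_⟩
      convert hy using 1
      ext i
      rw [coeff_trunc, Polynomial.coeff_one]
      split_ifs with h1 h2 h2
      · simp [h2]
      · omega
      · omega
      · rfl
    · set m := D / 2 with hm
      obtain ⟨F, hF, hFv⟩ := ih m (by omega)
      have h1 := (hF.comp ((HasCost.wire (id : PolyBits p lam d (D + 1) → _)).resize (m + 1))).resize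
        (D + 1)
      -- `f`, followed by its inverse to half the precision
      let ι := PolyBits p lam d (D + 1) ⊕ PolyBits p lam d (D + 1)
      have hf := HasCost.wire (α := ι) Sum.inl
      have hw := HasCost.wire (α := ι) Sum.inr
      obtain ⟨T, hT, hTv⟩ := exists_hasCost_mul (hM D) hf hw
      obtain ⟨T', hT', hTv'⟩ := exists_hasCost_sub b (hT.resize (D + 1)) (HasCost.const y)
      obtain ⟨S, hS, hSv⟩ := exists_hasCost_mul (hM D) hw hT'
      obtain ⟨S', hS', hSv'⟩ := exists_hasCost_sub b hw (hS.resize (D + 1))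
      refine ⟨_, (h1.share hS').mono ?_, fun x f hx hf0 => ?_⟩
      · have h2 : (if m = 0 then 0 else 116 * M m) ≤ 58 * M D := by
          rcases Nat.eq_zero_or_pos m with h0 | h0
          · simp [h0]
          · rw [if_neg h0.ne']
            have := hM2 m h0
            have := hMm (show 2 * m ≤ D by omega)
            omega
        rw [if_neg hD.ne']
        obtain ⟨c, hc, hcM⟩ := hM D
        have h3 := hc.le_size
        omega
      · have hfm : (trunc (m + 1) (f : (ModPow O p lam)⟦X⟧)).coeff 0 = 1 := by
          rw [coeff_trunc, if_pos (Nat.succ_pos _), Polynomial.coeff_coe, hf0]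
        have h2 := (hFv _ _ (hx.resize (m + 1)) hfm).resize_of_le (show m + 1 ≤ D + 1 by omega)
        set w := trunc (m + 1) (invOfUnit
          ((trunc (m + 1) (f : (ModPow O p lam)⟦X⟧) : Polynomial _) : (ModPow O p lam)⟦X⟧) 1)
        have h3 := hTv (Sum.elim x (resizeBits (D + 1) (F (resizeBits (m + 1) x)))) f w hx h2
        have h4 := hTv' _ _ _ (h3.resize (D + 1)) hy
        have h5 := hSv _ _ _ h2 h4
        have h6 := hSv' _ _ _ h2 (h5.resize (D + 1))
        suffices heq : trunc (D + 1) (invOfUnit (f : (ModPow O p lam)⟦X⟧) 1) =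
            w - trunc (D + 1) ((w * (trunc (D + 1) ((f * w : Polynomial (ModPow O p lam)) :
              (ModPow O p lam)⟦X⟧) - 1) : Polynomial (ModPow O p lam)) : (ModPow O p lam)⟦X⟧) by
          rw [heq]
          exact h6
        rw [← h6.trunc_eq le_rfl, trunc_eq_trunc_iff, ← dvd_neg, neg_sub, Polynomial.coe_sub]
        have hfc : constantCoeff (f : (ModPow O p lam)⟦X⟧) = 1 := by simpa using hf0
        refine X_pow_dvd_newton_inverse hfc (m := m + 1) (by omega)
          (t := (trunc (D + 1) ((f * w : Polynomial (ModPow O p lam)) : (ModPow O p lam)⟦X⟧) :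
            Polynomial _)) ?_ ?_ ?_
        · have h7 := X_pow_dvd_invOfUnit_sub (n := m + 1)
            (show constantCoeff ((trunc (m + 1) (f : (ModPow O p lam)⟦X⟧) : Polynomial _) :
              (ModPow O p lam)⟦X⟧) = 1 by
              rw [← coeff_zero_eq_constantCoeff_apply, Polynomial.coeff_coe, hfm]) hfc
            (by rw [← dvd_neg, neg_sub]; exact X_pow_dvd_sub_trunc _ _)
          have h8 := h7.sub (X_pow_dvd_sub_trunc (invOfUnit ((trunc (m + 1)
            (f : (ModPow O p lam)⟦X⟧) : Polynomial _) : (ModPow O p lam)⟦X⟧) 1) (m + 1))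
          convert h8 using 1
          ring
        · rw [← dvd_neg, neg_sub, ← Polynomial.coe_mul]
          exact X_pow_dvd_sub_trunc _ _
        · rw [← dvd_neg, neg_sub, ← Polynomial.coe_one, ← Polynomial.coe_sub, ← Polynomial.coe_mul]
          exact X_pow_dvd_sub_trunc _ _

end StepCircuit

/-! ### The circuit of the algorithm -/

section Algorithm

variable {p : ℕ} [Fact p.Prime] {O : Type*} [CommRing O] [Algebra ℤ_[p] O] {d lam : ℕ}
  {b : Module.Basis (Fin d) ℤ_[p] O} {M C : ℕ → ℕ}

/-- Halving `n` shows that one scalar product, of cost `M 0`, for every coefficient fits into `2 * M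
n`. -/
theorem succ_mul_le_of_two_mul_le (hM2 : ∀ k, 0 < k → 2 * M k ≤ M (2 * k)) (hMm : Monotone M)
    {n : ℕ} (hn : 0 < n) : (n + 1) * M 0 ≤ 2 * M n := by
  induction n using Nat.strong_induction_on with
  | _ n ih =>
    rcases Nat.lt_or_ge n 2 with h | h
    · obtain rfl : n = 1 := by omega
      have := hMm (Nat.zero_le 1)
      omega
    · have h1 := ih (n / 2) (by omega) (by omega)
      have h2 := hM2 (n / 2) (by omega)
      have h3 := hMm (show 2 * (n / 2) ≤ n by omega)
      have h4 : (n + 1) * M 0 ≤ 2 * ((n / 2 + 1) * M 0) := by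
        rw [← mul_assoc]
        exact Nat.mul_le_mul_right _ (by omega)
      omega

theorem exists_computesNewtonStep [Nontrivial O] (hlam : 0 < lam)
    (hM2 : ∀ k, 0 < k → 2 * M k ≤ M (2 * k)) (hMm : Monotone M)
    (hM : ∀ k, ∃ c, ComputesMul (p := p) (lam := lam) b k c ∧ c.size ≤ M k)
    {h : (ModPow O p lam)⟦X⟧} (hh : constantCoeff h = 1)
    (hC : ∀ k, ∃ c, ComputesComp (p := p) (lam := lam) b h k c ∧ c.size ≤ C k) {n : ℕ}
    (hn : 0 < n) (hv : ∀ i, i ≠ 0 → i ≤ n → padicValNat p i ≤ lam) :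
    ∃ c, ComputesNewtonStep (p := p) (lam := lam) b h n c ∧ c.size ≤ 244 * (M n + C n) := by
  obtain ⟨D, rfl⟩ : ∃ D, n = D + 1 := ⟨n - 1, by omega⟩
  obtain ⟨comp, hcomp, hcompC⟩ := hC (D + 1)
  obtain ⟨inv, hinv, hinvv⟩ := exists_hasCost_invOfUnit hM2 hMm hM D
  let ι := PolyBits p lam d (D + 1) ⊕ PolyBits p lam d ((D + 1) / 2 + 1)
  -- `h(u)`
  have h1 := (HasCost.of_circuit comp).comp ((HasCost.wire (α := ι) Sum.inr).resize (D + 1))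
  -- the primitive of `u' / h(u) - g`
  let ι₁ := ι ⊕ PolyBits p lam d (D + 1)
  have hg := HasCost.wire (α := ι₁) (Sum.inl ∘ Sum.inl)
  have hu := HasCost.wire (α := ι₁) (Sum.inl ∘ Sum.inr)
  have hw := hinv.comp (HasCost.wire (α := ι₁) Sum.inr)
  obtain ⟨du, hdu, hduv⟩ := exists_hasCost_derivative (hM 0) (hu.resize (D + 1 + 1))
  obtain ⟨z, hz, hzv⟩ := exists_hasCost_mul (hM (D + 1)) (hdu.resize (D + 1 + 1))
    (hw.resize (D + 1 + 1))
  obtain ⟨e, he, hev⟩ := exists_hasCost_sub b (hz.resize (D + 1)) hg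
  obtain ⟨E, hE, hEv⟩ := exists_hasCost_fixedPrimitive hlam (hM 0) hv he
  -- the result
  let ι₂ := ι₁ ⊕ (PolyBits p lam d (D + 1 + 1) ⊕ Unit)
  obtain ⟨s, hs, hsv⟩ := exists_hasCost_mul (hM (D + 1))
    ((HasCost.wire (α := ι₂) (Sum.inl ∘ Sum.inr)).resize (D + 1 + 1))
    (HasCost.wire (α := ι₂) (Sum.inr ∘ Sum.inl))
  obtain ⟨r, hr, hrv⟩ := exists_hasCost_sub b
    ((HasCost.wire (α := ι₂) (Sum.inl ∘ Sum.inl ∘ Sum.inr)).resize (D + 1 + 1))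
    (hs.resize (D + 1 + 1))
  have h2 := h1.share (hE.share (hr.pair (HasCost.wire (α := ι₂)
    (Sum.inr ∘ Sum.inr : Unit → ι₂))))
  obtain ⟨c, hc, hcs⟩ := h2
  refine ⟨c, fun x y g u hx hy hu0 => ?_, hcs.trans ?_⟩
  · rw [hc]
    set H := trunc (D + 1) h with hH
    have hH0 : H.coeff 0 = 1 := by
      rw [hH, coeff_trunc, if_pos (Nat.succ_pos D)]
      simpa using hh
    set f := trunc (D + 1) ((H.comp u : Polynomial (ModPow O p lam)) : (ModPow O p lam)⟦X⟧) with hf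
    have hf0 : f.coeff 0 = 1 := by
      rw [hf, coeff_trunc, if_pos (Nat.succ_pos D), coeff_zero_eq_constantCoeff_apply,
        constantCoeff_comp hu0, hH0]
    have hxf : Encodes b (comp.eval (resizeBits (D + 1) y)) f :=
      hcomp _ _ (hy.resize_of_le (by omega)) hu0
    set xf := comp.eval (resizeBits (D + 1) y)
    set w := trunc (D + 1) (invOfUnit (f : (ModPow O p lam)⟦X⟧) 1) with hwdef
    have hxw : Encodes b (inv xf) w := hinvv _ _ hxf hf0
    have hz1 := hzv (Sum.elim (Sum.elim x y) xf) _ _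
      ((hduv (Sum.elim (Sum.elim x y) xf) u (hy.resize_of_le (by omega))).resize_of_le
        (Nat.le_succ _)) (hxw.resize_of_le (Nat.le_succ _))
    have he1 := hev (Sum.elim (Sum.elim x y) xf) _ _ (hz1.resize (D + 1)) hx
    have hE1 := hEv (Sum.elim (Sum.elim x y) xf) _ he1
    set xE := E (Sum.elim (Sum.elim x y) xf)
    have hfc : X ^ (D + 1) ∣ (f : (ModPow O p lam)⟦X⟧) -
        ((H.comp u : Polynomial (ModPow O p lam)) : (ModPow O p lam)⟦X⟧) := by
      rw [← dvd_neg, neg_sub]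
      exact X_pow_dvd_sub_trunc _ _
    have hstep := newtonStep_eq b (g := g) hfc (e := ((trunc (D + 1)
      ((Polynomial.derivative u * w : Polynomial (ModPow O p lam)) : (ModPow O p lam)⟦X⟧) - g :
        Polynomial (ModPow O p lam)) : (ModPow O p lam)⟦X⟧)) (by
      have e1 := X_pow_dvd_invOfUnit_sub (show constantCoeff (f : (ModPow O p lam)⟦X⟧) = 1 by
        rw [← coeff_zero_eq_constantCoeff_apply, Polynomial.coeff_coe, hf0])
        ((constantCoeff_comp hu0).trans hH0) hfc
      have e2 := X_pow_dvd_sub_trunc (invOfUnit (f : (ModPow O p lam)⟦X⟧) 1) (D + 1)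
      have e3 := X_pow_dvd_sub_trunc ((Polynomial.derivative u * w :
        Polynomial (ModPow O p lam)) : (ModPow O p lam)⟦X⟧) (D + 1)
      have e4 := ((e1.sub e2).mul_left ((Polynomial.derivative u : Polynomial (ModPow O p lam)) :
        (ModPow O p lam)⟦X⟧)).sub e3
      convert e4 using 1
      rw [Polynomial.coe_sub, Polynomial.coe_mul, ← hwdef]
      ring)
    rw [hstep]
    cases hEr : fixedPrimitive p lam b (D + 1) ((trunc (D + 1)
      ((Polynomial.derivative u * w : Polynomial (ModPow O p lam)) : (ModPow O p lam)⟦X⟧) - g :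
        Polynomial (ModPow O p lam)) : (ModPow O p lam)⟦X⟧) with
    | none =>
      rw [hEr] at hE1
      exact hE1
    | some Ep =>
      rw [hEr] at hE1
      refine ⟨hE1.1, ?_⟩
      have hs1 := hsv (Sum.elim (Sum.elim (Sum.elim x y) xf) xE) f Ep
        (hxf.resize_of_le (Nat.le_succ _)) hE1.2
      have hr1 := hrv (Sum.elim (Sum.elim (Sum.elim x y) xf) xE) u _
        (hy.resize_of_le (by omega)) (hs1.resize (D + 1 + 1))
      suffices heq : trunc (D + 1 + 1) ((u : (ModPow O p lam)⟦X⟧) -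
          (f : (ModPow O p lam)⟦X⟧) * (Ep : (ModPow O p lam)⟦X⟧)) =
          (u - trunc (D + 1 + 1) ((f * Ep : Polynomial (ModPow O p lam)) : (ModPow O p lam)⟦X⟧) :
            Polynomial (ModPow O p lam)) by
        change Encodes b _ (trunc (D + 1 + 1) ((u : (ModPow O p lam)⟦X⟧) -
          (f : (ModPow O p lam)⟦X⟧) * (Ep : (ModPow O p lam)⟦X⟧)))
        rw [heq]
        exact hr1
      rw [← hr1.trunc_eq le_rfl, trunc_eq_trunc_iff, ← dvd_neg, Polynomial.coe_sub]
      convert X_pow_dvd_sub_trunc ((f * Ep : Polynomial (ModPow O p lam)) :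
        (ModPow O p lam)⟦X⟧) (D + 1 + 1) using 1
      rw [Polynomial.coe_mul]
      ring
  -- In units of `M n`: `116` for the inversion, `2` for the products, `28` for each of the two
  -- subtractions, `2` each for the scalar products in the derivative and in the primitive, and `66`
  -- for the rest of the primitive; in total `244`. The composition adds `C n`.
  · obtain ⟨c', hc', hcM⟩ := hM (D + 1)
    have e1 := hc'.le_size
    have e2 := succ_mul_le_of_two_mul_le hM2 hMm hn
    have e3 : (if D = 0 then 0 else 116 * M D) ≤ 116 * M (D + 1) := by
      have := hMm (Nat.le_succ D)
      split_ifs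
      · exact Nat.zero_le _
      · exact Nat.mul_le_mul_left _ this
    have e4 : (D + 1) * (d * Nat.size (p ^ lam - 1)) ≤ (D + 1 + 1) * (d * Nat.size (p ^ lam - 1)) :=
      Nat.mul_le_mul_right _ (Nat.le_succ _)
    have e5 : (D + 1) * M 0 ≤ (D + 1 + 1) * M 0 := Nat.mul_le_mul_right _ (Nat.le_succ _)
    omega

/-- The circuit of the algorithm computes its output. -/
theorem encodesResult_dsolCircuit {h : (ModPow O p lam)⟦X⟧} (hh : constantCoeff h = 1) {n : ℕ}
    {S : ∀ k : ℕ, BoolCircuit (PolyBits p lam d k ⊕ PolyBits p lam d (k / 2 + 1))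
      (PolyBits p lam d (k + 1) ⊕ Unit)}
    (hS : ∀ k, 0 < k → k ≤ n → ComputesNewtonStep (p := p) (lam := lam) b h k (S k))
    {k : ℕ} (hk : k ≤ n) {x : PolyBits p lam d k → Bool} {g g' : Polynomial (ModPow O p lam)}
    (hx : Encodes b x g) (hg : ∀ i < k, g.coeff i = g'.coeff i) :
    EncodesResult b ((dsolCircuit S k).eval x) (DSol p lam b g' (trunc n h) k) := by
  induction k using Nat.strong_induction_on generalizing g with
  | _ k ih =>
    rcases k with _ | k
    · rw [dsolCircuit, DSol]
      refine ⟨rfl, (encodes_iff _).2 ⟨fun i => ?_, fun i _ => Polynomial.coeff_zero i⟩⟩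
      rw [Polynomial.coeff_zero]
      exact encodesElem_zero b
    · have hm : (k + 1) / 2 ≤ k + 1 := Nat.div_le_self _ _
      set x₁ : PolyBits p lam d ((k + 1) / 2) → Bool := fun z => x (Fin.castLE hm z.1, z.2) with hx₁
      have hx₁g : Encodes b x₁ (trunc ((k + 1) / 2) (g : (ModPow O p lam)⟦X⟧)) := by
        convert hx.resize ((k + 1) / 2) using 1
        ext z
        have : (z.1 : ℕ) < k + 1 := by omega
        simp only [resizeBits, hx₁, dif_pos this]
        rfl
      have h1 := ih ((k + 1) / 2) (by omega) (by omega) hx₁g fun i hi => by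
        rw [coeff_trunc, if_pos hi, Polynomial.coeff_coe, hg i (by omega)]
      have heval : ∃ y, (dsolCircuit S (k + 1)).eval x = Sum.elim
          (fun z => (S (k + 1)).eval (Sum.elim x y) (Sum.inl z))
          (fun _ => (S (k + 1)).eval (Sum.elim x y) (Sum.inr ()) ||
            (dsolCircuit S ((k + 1) / 2)).eval x₁ (Sum.inr ())) ∧
          y = fun z => (dsolCircuit S ((k + 1) / 2)).eval x₁ (Sum.inl z) := by
        refine ⟨_, ?_, rfl⟩
        rw [dsolCircuit]
        ext (z | z)
        · simp only [BoolCircuit.eval, Sum.elim_inl]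
          congr 1
          ext (q | q) <;> rfl
        · simp only [BoolCircuit.eval, Sum.elim_inl, Sum.elim_inr]
          congr 2
          ext (q | q) <;> rfl
      obtain ⟨y, hev, hy⟩ := heval
      rw [hev, DSol]
      cases hu : DSol p lam b g' (trunc n h) ((k + 1) / 2) with
      | none =>
        rw [hu] at h1
        -- After an error the bits passed on need not encode anything; the earlier flag alone
        -- decides.
        have h2 : (dsolCircuit S ((k + 1) / 2)).eval x₁ (Sum.inr ()) = true := h1
        change (_ || _) = true
        rw [h2, Bool.or_true]
      | some u =>
        rw [hu] at h1
        obtain ⟨h2, h3⟩ := h1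
        rw [← hy] at h3
        have hu0 := coeff_zero_DSol _ hu
        have h4 := hS (k + 1) k.succ_pos hk x y g u hx h3 hu0
        rw [newtonStep_congr b (g' := g') (h' := trunc n h) k.succ_pos hg (fun i hi => by
          rw [coeff_trunc, coeff_trunc, if_pos hi, if_pos (by omega)])
          (by rw [coeff_trunc, if_pos k.succ_pos]; simpa using hh) hu0] at h4
        rw [Option.bind_some]
        cases hr : newtonStep p lam b (k + 1) g' (trunc n h) u with
        | none =>
          rw [hr] at h4
          have h5 : (S (k + 1)).eval (Sum.elim x y) (Sum.inr ()) = true := h4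
          change (_ || _) = true
          rw [h5, Bool.true_or]
        | some r =>
          rw [hr] at h4
          refine ⟨?_, h4.2⟩
          change (_ || _) = false
          rw [h4.1, h2]
          rfl

/-- By the doubling inequality all earlier iterations together cost no more than the bound `T k` for
the last. The `+ 1` is the gate that merges the two flags. -/
theorem dsolCircuit_size_le
    {S : ∀ k : ℕ, BoolCircuit (PolyBits p lam d k ⊕ PolyBits p lam d (k / 2 + 1))
      (PolyBits p lam d (k + 1) ⊕ Unit)} {T : ℕ → ℕ} (hT : Monotone T)
    (hT2 : ∀ k, 0 < k → 2 * T k ≤ T (2 * k)) {n : ℕ}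
    (hS : ∀ k, 0 < k → k ≤ n → (S k).size + 1 ≤ T k) {k : ℕ} (hk : k ≤ n) :
    (dsolCircuit S k).size ≤ 2 * T k := by
  induction k using Nat.strong_induction_on with
  | _ k ih =>
    rcases k with _ | k
    · rw [dsolCircuit]
      exact Nat.zero_le _
    · have h1 : (dsolCircuit S (k + 1)).size =
          (dsolCircuit S ((k + 1) / 2)).size + (S (k + 1)).size + 1 := by
        rw [dsolCircuit]
        simp only [BoolCircuit.size]
        omega
      have h2 := hS (k + 1) k.succ_pos hk
      have h3 : (dsolCircuit S ((k + 1) / 2)).size ≤ T (k + 1) := by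
        rcases Nat.eq_zero_or_pos ((k + 1) / 2) with h0 | h0
        · rw [h0, dsolCircuit]
          exact Nat.zero_le _
        · exact (ih ((k + 1) / 2) (by omega) (by omega)).trans
            ((hT2 _ h0).trans (hT (by omega)))
      omega

end Algorithm

end PadicODE

/-! ### Correctness and complexity combined -/

theorem theorem2 :
    -- `A` is the constant of the complexity bound; it is absolute
    ∃ A : ℕ, ∀ (p : ℕ) [Fact p.Prime]
      (K : Type*) [Field K] [Algebra ℚ_[p] K] [FiniteDimensional ℚ_[p] K]
      [Algebra ℤ_[p] K] [IsScalarTower ℤ_[p] ℚ_[p] K]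
      [Algebra.FormallyUnramified ℤ_[p] (integralClosure ℤ_[p] K)]
      (d : ℕ) (b : Module.Basis (Fin d) ℤ_[p] (integralClosure ℤ_[p] K))
      (h : PowerSeries (integralClosure ℤ_[p] K)) (_ : PowerSeries.constantCoeff h = 1)
      (n κ lam : ℕ) (_ : 0 < κ) (_ : p = 2 → 1 < κ) (_ : Nat.log p n + κ ≤ lam),
      -- correctness
      (∀ g : PowerSeries (integralClosure ℤ_[p] K),
        (∀ i ≤ n, PowerSeries.coeff i
          (PadicODE.Y (h.map (algebraMap (integralClosure ℤ_[p] K) K))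
            (g.map (algebraMap (integralClosure ℤ_[p] K) K))) ∈ integralClosure ℤ_[p] K) →
        ∃ v : Polynomial (PadicODE.ModPow (integralClosure ℤ_[p] K) p lam),
          PadicODE.DSol p lam b
            (PowerSeries.trunc n (g.map (PadicODE.red p lam)))
            (PowerSeries.trunc n (h.map (PadicODE.red p lam))) n = some v ∧
          v.natDegree ≤ n ∧
          ∀ i ≤ n, ∀ a c : integralClosure ℤ_[p] K,
            (a : K) = PowerSeries.coeff i
              (PadicODE.Y (h.map (algebraMap (integralClosure ℤ_[p] K) K))
                (g.map (algebraMap (integralClosure ℤ_[p] K) K))) →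
            PadicODE.red p lam c = v.coeff i →
            (p : integralClosure ℤ_[p] K) ^ κ ∣ c - a) ∧
      -- complexity: `M k` bounds the cost of products and `C k` the cost of compositions with `h`
      ∀ M C : ℕ → ℕ, Monotone M → Monotone C →
        (∀ k, 0 < k → 2 * M k ≤ M (2 * k)) → (∀ k, 0 < k → 2 * C k ≤ C (2 * k)) →
        (∀ k, ∃ c, PadicODE.ComputesMul (p := p) (lam := lam) b k c ∧ c.size ≤ M k) →
        (∀ k, ∃ c, PadicODE.ComputesComp (p := p) (lam := lam) b
          (h.map (PadicODE.red p lam)) k c ∧ c.size ≤ C k) →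
        ∃ S : ∀ k : ℕ, PadicODE.BoolCircuit
            (PadicODE.PolyBits p lam d k ⊕ PadicODE.PolyBits p lam d (k / 2 + 1))
            (PadicODE.PolyBits p lam d (k + 1) ⊕ Unit),
          (∀ k, 0 < k → k ≤ n → PadicODE.ComputesNewtonStep (p := p) (lam := lam) b
            (h.map (PadicODE.red p lam)) k (S k)) ∧
          (∀ x g, PadicODE.Encodes b x g →
            PadicODE.EncodesResult b ((PadicODE.dsolCircuit S n).eval x)
              (PadicODE.DSol p lam b g
                (PowerSeries.trunc n (h.map (PadicODE.red p lam))) n)) ∧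
          (PadicODE.dsolCircuit S n).size ≤ A * (M n + C n) := by
  -- `490 = 2 * 245`: a step costs `244`, merging the flags is covered by `1` more, and the
  -- recursion doubles the total.
  refine ⟨490, fun p _ K _ _ _ _ _ _ d b h hh n κ lam hκ _ hlam => ⟨fun g hg => ?_,
    fun M C hMm hCm hM2 hC2 hM hC => ?_⟩⟩
  · have : CharZero K := charZero_of_injective_algebraMap (algebraMap ℚ_[p] K).injective
    refine PadicODE.exists_DSol_eq_some_of_isSolution (integralClosure ℤ_[p] K) b h hh hκ hlam g
      (PadicODE.isSolution_Y _ _ ?_) hg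
    rw [← PowerSeries.coeff_zero_eq_constantCoeff_apply, PowerSeries.coeff_map,
      PowerSeries.coeff_zero_eq_constantCoeff_apply, hh, map_one]
  · have hlam0 : 0 < lam := by omega
    have hh' : PowerSeries.constantCoeff (h.map (PadicODE.red p lam)) = 1 := by
      rw [← PowerSeries.coeff_zero_eq_constantCoeff_apply, PowerSeries.coeff_map,
        PowerSeries.coeff_zero_eq_constantCoeff_apply, hh, map_one]
    have hstep : ∀ k, ∃ c : PadicODE.BoolCircuit
        (PadicODE.PolyBits p lam d k ⊕ PadicODE.PolyBits p lam d (k / 2 + 1))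
        (PadicODE.PolyBits p lam d (k + 1) ⊕ Unit), 0 < k → k ≤ n →
        PadicODE.ComputesNewtonStep (p := p) (lam := lam) b (h.map (PadicODE.red p lam)) k c ∧
          c.size ≤ 244 * (M k + C k) := by
      intro k
      by_cases hk : 0 < k ∧ k ≤ n
      · obtain ⟨c, hc⟩ := PadicODE.exists_computesNewtonStep hlam0 hM2 hMm hM hh' hC hk.1
          fun i _ hi => (padicValNat_le_nat_log i).trans
            ((Nat.log_mono_right (hi.trans hk.2)).trans (by omega))
        exact ⟨c, fun _ _ => hc⟩
      -- Outside the range `0 < k ≤ n` any circuit will do.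
      · exact ⟨.seq (.wire Empty.elim) (.seq (.const false) (.wire fun _ => ())),
          fun h1 h2 => absurd ⟨h1, h2⟩ hk⟩
    choose S hS using hstep
    -- Positivity of `M k` lets the bound absorb the gate that merges the flags.
    have hMpos : ∀ k, 0 < k → 1 ≤ M k := fun k hk => by
      obtain ⟨c, hc, hcM⟩ := hM k
      have h1 := hc.le_size
      have h2 : 0 < (k + 1) * (d * Nat.size (p ^ lam - 1)) :=
        Nat.mul_pos k.succ_pos (Nat.mul_pos (PadicODE.card_coords_pos b)
          (PadicODE.size_pos hlam0))
      omega
    refine ⟨S, fun k h1 h2 => (hS k h1 h2).1, fun x g hx =>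
      PadicODE.encodesResult_dsolCircuit hh' (fun k h1 h2 => (hS k h1 h2).1) le_rfl hx
        fun _ _ => rfl, ?_⟩
    have hsize := PadicODE.dsolCircuit_size_le (S := S) (T := fun k => 245 * (M k + C k))
      (fun i j hij => Nat.mul_le_mul_left _ (add_le_add (hMm hij) (hCm hij)))
      (fun k hk => by
        have h1 := hM2 k hk
        have h2 := hC2 k hk
        omega)
      (n := n) (fun k hk hkn => by
        have h1 := (hS k hk hkn).2
        have h2 := hMpos k hk
        omega) le_rfl
    omega
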